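/- **Conventions.** Let $\mathbb T=[0,2\pi)$; functions on $\mathbb T$ are identified with $2\pi$-periodic functions on $\mathbb R$ of the same regularity, and $W^{1,\infty}(\mathbb T)$ is the space of $2\pi$-periodic functions in $W^{1,\infty}_{loc}(\mathbb R)$, each identified with its continuous (Lipschitz) representative. For $u\in W^{1,\infty}(\mathbb T)$ we write $u''+u\ge 0$ if $\int_{\mathbb T}(uv-u'v')\,d\theta\ge 0$ for all $v\in W^{1,\infty}(\mathbb T)$ with $v\ge 0$; then $u''+u$, computed in the sense of distributions on $\mathbb R$, is a (unique) nonnegative locally finite measure on $\mathbb R$, and $S_u$ denotes its support. For $u>0$ let $\Omega_u=\{(r\cos\theta,r\sin\theta):\theta\in\mathbb R,\ 0\le r<1/u(\theta)\}\subset\mathbb R^2$, and let $m(u)=\frac12\int_{\mathbb T}u^{-2}\,d\theta\in[0,\infty]$. **Theorem 2.1.** Let $G:\mathbb T\times\mathbb R\times\mathbb R\to\mathbb R$, $(\theta,u,p)\mapsto G(\theta,u,p)$, be of class $C^2$, and set $j(u)=\int_{\mathbb T}G(\theta,u(\theta),u'(\theta))\,d\theta$ for $u\in W^{1,\infty}(\mathbb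 T)$. Let $u_0$ be a solution of one of the problems $$\min\{j(u):\ u\in W^{1,\infty}(\mathbb T),\ u''+u\ge 0,\ a\le u\le b\},\qquad 0<a<b, \tag{1}$$ $$\min\{j(u):\ u\in W^{1,\infty}(\mathbb T),\ u''+u\ge 0,\ m(u)=m_0\},\qquad m_0>0, \tag{2}$$ and assume that $G_{pp}(\theta,u_0(\theta),u_0'(\theta))<0$ for all $\theta\in\mathbb T$, where at the points at which $u_0$ is not differentiable the inequality is required for both one-sided derivatives (which exist everywhere). * If $u_0$ is a solution of (1), then $S_{u_0}\cap I$ is finite for every interval $I=(\gamma_1,\gamma_2)\subset\{\theta\in\mathbb R: a<u_0(\theta)<b\}$ with $\gamma_1,\gamma_2\in\mathbb R$. In particular $\Omega_{u_0}$ is locally polygonal inside the annulus $\{1/b\le|x|\le 1/a\}$: every $x\in\partial\Omega_{u_0}$ with $1/b<|x|<1/a$ has a neighbourhood in which $\Omega_{u_0}$ coincides with an open convex polygon. * If $u_0>0$ is a solution of (2), then $S_{u_0}\cap\mathbb T$ is finite, and so $\Omega_{u_0}$ is an (open convex) polygon. Here an open convex polygon is the nonempty interior of the convex hull of finitely many points.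 -/

import Mathlib

open Set MeasureTheory Topology
open scoped ContDiff ENNReal NNReal

namespace ConvexShape

/-- The Euclidean plane. -/
abbrev Plane : Type := EuclideanSpace ℝ (Fin 2)

/-- `W^{1,∞}(𝕋)`: every class of `2π`-periodic `W^{1,∞}_loc(ℝ)` functions has exactly one continuous
representative, and these representatives are the `2π`-periodic Lipschitz functions on `ℝ`; the weak
derivative is the derivative in the ordinary sense, which exists almost everywhere. -/
def W1inf (u : ℝ → ℝ) : Prop :=
  (∃ K : ℝ≥0, LipschitzWith K u) ∧ Function.Periodic u (2 * Real.pi)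

/-- The convexity constraint `u'' + u ≥ 0`:
`∫_𝕋 (u v - u' v') dθ ≥ 0` for all nonnegative `v ∈ W^{1,∞}(𝕋)`. -/
def ConvexityConstraint (u : ℝ → ℝ) : Prop :=
  ∀ v : ℝ → ℝ, W1inf v → (∀ θ, 0 ≤ v θ) →
    0 ≤ ∫ θ in (0 : ℝ)..(2 * Real.pi), (u θ * v θ - deriv u θ * deriv v θ)

/-- `ν` is the (nonnegative, locally finite) measure `u'' + u` on `ℝ`, the second derivative being
taken in the sense of distributions. -/
structure IsCurvatureMeasure (u : ℝ → ℝ) (ν : Measure ℝ) : Prop where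
  locallyFinite : IsLocallyFiniteMeasure ν
  integral_eq : ∀ φ : ℝ → ℝ, ContDiff ℝ ∞ φ → HasCompactSupport φ →
    ∫ θ, u θ * (deriv (deriv φ) θ + φ θ) = ∫ θ, φ θ ∂ν

/-- The functional `j(u) = ∫_𝕋 G(θ, u(θ), u'(θ)) dθ`. -/
noncomputable def functional (G : ℝ → ℝ → ℝ → ℝ) (u : ℝ → ℝ) : ℝ :=
  ∫ θ in (0 : ℝ)..(2 * Real.pi), G θ (u θ) (deriv u θ)

/-- `m(u) = (1/2) ∫_𝕋 dθ / u²`, with values in `[0, ∞]` (and `1 / 0 = ∞`). -/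
noncomputable def area (u : ℝ → ℝ) : ℝ≥0∞ :=
  2⁻¹ * ∫⁻ θ in Ico (0 : ℝ) (2 * Real.pi), (ENNReal.ofReal (u θ ^ 2))⁻¹

/-- Admissible functions for the annulus constraint. -/
def annulusClass (a b : ℝ) : Set (ℝ → ℝ) :=
  {u | W1inf u ∧ ConvexityConstraint u ∧ ∀ θ, a ≤ u θ ∧ u θ ≤ b}

/-- Admissible functions for the area constraint. -/
def areaClass (m₀ : ℝ) : Set (ℝ → ℝ) :=
  {u | W1inf u ∧ ConvexityConstraint u ∧ area u = ENNReal.ofReal m₀}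

/-- `u₀` is a solution of `min {j(u) : u ∈ K}`. -/
def IsSolution (G : ℝ → ℝ → ℝ → ℝ) (K : Set (ℝ → ℝ)) (u₀ : ℝ → ℝ) : Prop :=
  u₀ ∈ K ∧ ∀ u ∈ K, functional G u₀ ≤ functional G u

/-- `G_pp(θ, u, p)`, the second partial derivative in the third variable. -/
noncomputable def Gpp (G : ℝ → ℝ → ℝ → ℝ) (θ u p : ℝ) : ℝ :=
  iteratedDeriv 2 (fun q => G θ u q) p

/-- `G_pp(θ, u₀, u₀') < 0` for all `θ`, where `u₀'(θ)` runs over the right and the left derivative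
of `u₀` at `θ`. For a function with `u₀'' + u₀ ≥ 0` both exist everywhere; they are equal except at
the corners. -/
def StronglyConcaveAlong (G : ℝ → ℝ → ℝ → ℝ) (u₀ : ℝ → ℝ) : Prop :=
  ∀ θ p : ℝ, (HasDerivWithinAt u₀ p (Ioi θ) θ ∨ HasDerivWithinAt u₀ p (Iio θ) θ) →
    Gpp G θ (u₀ θ) p < 0

/-- The domain `Ω_u = {(r, θ) : 0 ≤ r < 1 / u(θ)}` in polar coordinates. -/
noncomputable def shape (u : ℝ → ℝ) : Set Plane :=
  {x | ∃ r θ : ℝ, 0 ≤ r ∧ r < 1 / u θ ∧ x = !₂[r * Real.cos θ, r * Real.sin θ]}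

/-- A (nondegenerate, open) convex polygon: the nonempty interior of the convex hull of finitely
many points. -/
def IsConvexPolygon (P : Set Plane) : Prop :=
  P.Nonempty ∧ ∃ V : Finset Plane, P = interior (convexHull ℝ (V : Set Plane))

/-- `Ω` is locally polygonal inside the region `A`: near each of its boundary points that lies in
`A`, the set `Ω` coincides with a convex polygon. -/
def LocallyPolygonalIn (Ω A : Set Plane) : Prop :=
  ∀ x ∈ frontier Ω ∩ A, ∃ P : Set Plane, IsConvexPolygon P ∧ ∃ N ∈ 𝓝 x, Ω ∩ N = P ∩ N

/-- The interior of the annulus `A(a, b) = {1 / b ≤ r ≤ 1 / a}`. -/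
def openAnnulus (a b : ℝ) : Set Plane :=
  {x | 1 / b < ‖x‖ ∧ ‖x‖ < 1 / a}

/-- One half of the uniqueness of the measure `u'' + u`. -/
theorem IsCurvatureMeasure.measure_Icc_le {u : ℝ → ℝ} {ν₁ ν₂ : Measure ℝ}
    (h₁ : IsCurvatureMeasure u ν₁) (h₂ : IsCurvatureMeasure u ν₂) {c d : ℝ} (hcd : c ≤ d) :
    ν₁ (Icc c d) ≤ ν₂ (Icc c d) := by
  have := h₁.locallyFinite
  have := h₂.locallyFinite
  have key : ∀ ε : ℝ, 0 < ε → ν₁ (Icc c d) ≤ ν₂ (Metric.cthickening ε (Icc c d)) := by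
    intro ε hε
    let f : ContDiffBump ((c + d) / 2 : ℝ) :=
      ⟨(d - c) / 2 + ε / 2, (d - c) / 2 + ε, by linarith, by linarith⟩
    have hint₁ : Integrable f ν₁ := f.continuous.integrable_of_hasCompactSupport f.hasCompactSupport
    have hint₂ : Integrable f ν₂ := f.continuous.integrable_of_hasCompactSupport f.hasCompactSupport
    have heq : ∫ θ, f θ ∂ν₁ = ∫ θ, f θ ∂ν₂ := by
      rw [← h₁.integral_eq f f.contDiff f.hasCompactSupport,
        ← h₂.integral_eq f f.contDiff f.hasCompactSupport]
    have heq' : ∫⁻ θ, ENNReal.ofReal (f θ) ∂ν₁ = ∫⁻ θ, ENNReal.ofReal (f θ) ∂ν₂ := by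
      rw [← ofReal_integral_eq_lintegral_ofReal hint₁ (.of_forall fun _ => f.nonneg),
        ← ofReal_integral_eq_lintegral_ofReal hint₂ (.of_forall fun _ => f.nonneg), heq]
    calc ν₁ (Icc c d) = ∫⁻ θ, (Icc c d).indicator 1 θ ∂ν₁ :=
          (lintegral_indicator_one measurableSet_Icc).symm
      _ ≤ ∫⁻ θ, ENNReal.ofReal (f θ) ∂ν₁ := by
          refine lintegral_mono fun θ => ?_
          by_cases hθ : θ ∈ Icc c d
          · have : f θ = 1 := f.one_of_mem_closedBall (by
              rw [Real.closedBall_eq_Icc]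
              change θ ∈ Icc ((c + d) / 2 - ((d - c) / 2 + ε / 2))
                ((c + d) / 2 + ((d - c) / 2 + ε / 2))
              exact ⟨by linarith [hθ.1], by linarith [hθ.2]⟩)
            simp [this, indicator_of_mem hθ]
          · simp [indicator_of_notMem hθ]
      _ = ∫⁻ θ, ENNReal.ofReal (f θ) ∂ν₂ := heq'
      _ ≤ ∫⁻ θ, (Metric.cthickening ε (Icc c d)).indicator 1 θ ∂ν₂ := by
          refine lintegral_mono fun θ => ?_
          by_cases hθ : θ ∈ Metric.cthickening ε (Icc c d)
          · simpa [indicator_of_mem hθ] using f.le_one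
          · have : f θ = 0 := by
              by_contra hne
              have hmem : θ ∈ Function.support f := hne
              rw [f.support_eq, Real.ball_eq_Ioo] at hmem
              change θ ∈ Ioo ((c + d) / 2 - ((d - c) / 2 + ε))
                ((c + d) / 2 + ((d - c) / 2 + ε)) at hmem
              apply hθ
              refine Metric.mem_cthickening_of_dist_le θ (max c (min d θ)) ε _
                ⟨le_max_left _ _, max_le hcd (min_le_left _ _)⟩ ?_
              rw [Real.dist_eq, abs_le]
              rcases max_cases c (min d θ) with h | h <;> rcases min_cases d θ with h' | h' <;>
                constructor <;> linarith [hmem.1, hmem.2]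
            simp [this]
      _ = ν₂ (Metric.cthickening ε (Icc c d)) :=
          lintegral_indicator_one Metric.isClosed_cthickening.measurableSet
  have hlim : Filter.Tendsto (fun ε => ν₂ (Metric.cthickening ε (Icc c d))) (𝓝 0)
      (𝓝 (ν₂ (Icc c d))) := tendsto_measure_cthickening_of_isCompact isCompact_Icc
  have hlim' := hlim.mono_left (nhdsWithin_le_nhds (s := Ioi (0 : ℝ)))
  exact ge_of_tendsto hlim' (by filter_upwards [self_mem_nhdsWithin] with ε hε using key ε hε)

/-- The measure `u'' + u` is determined by `u`. -/
theorem IsCurvatureMeasure.unique {u : ℝ → ℝ} {ν₁ ν₂ : Measure ℝ}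
    (h₁ : IsCurvatureMeasure u ν₁) (h₂ : IsCurvatureMeasure u ν₂) : ν₁ = ν₂ := by
  have := h₁.locallyFinite
  exact Measure.ext_of_Icc' ν₁ ν₂ (fun _ _ _ => isCompact_Icc.measure_lt_top.ne)
    fun _ _ hcd => le_antisymm (h₁.measure_Icc_le h₂ hcd) (h₂.measure_Icc_le h₁ hcd)

end ConvexShape

/-!
The condition `u'' + u ≥ 0` is converted into a primitive of the curvature: with `U' = u` and
`U₂' = U`, testing against hat functions shows that `u + U₂` is convex, and its right derivative `H`
is a monotone right-continuous function with `u' = H - U`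
(`ConvexityConstraint.exists_stieltjes`). The Stieltjes measure of `H` is `u'' + u`
(`CurvaturePrimitive.isCurvatureMeasure`).

Suppose that the support of this measure accumulates at `θ₀`. Then any neighbourhood of `θ₀` contains
points `q 0 < ⋯ < q 4` at which `H` takes increasing values. Multiplying the curvature of `u` by a
constant on each of the four resulting pieces gives the curvature of a function `v` with vanishing
Cauchy data at `q 0`. Three linear conditions on the four constants, the vanishing of the Cauchy data
at `q 4` and one prescribed orthogonality relation, leave a nonzero `v` supported in `[q 0, q 4]`.
The curvature of `v` is bounded by a multiple of that of `u`, so `u + t v` satisfies the convexity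
constraint for all small `t` of *either* sign (`CurvaturePrimitive.exists_perturbation`). The pieces
are cut along the values of `H`, by truncating `H`, so that atoms cause no difficulty.

Since `G` is strictly concave in `p` near the two points `(θ₀, u θ₀, u' (θ₀ ± 0))`, the second
difference `j (u + t v) + j (u - t v) - 2 j u` is at most `t² (C ∫ v² - K ∫ v'²)`, and the Poincaré
inequality makes this negative on short intervals, even after adding `D t² ∫ v²`
(`StronglyConcaveAlong.second_variation_neg`). Hence one of `u ± t v` is better than `u`. No Lagrange
multiplier is needed for the area: if `v` is orthogonal to `u⁻³`, the first variation of the area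
along `v` vanishes, the area of `u ± t v` is restored by a scaling factor `1 + O(t² ∫ v²)`, and the
cost of the scaling is absorbed by the term with `D` (`finite_support_of_area`). Under the constraint
`a ≤ u ≤ b` small perturbations inside `{a < u < b}` are admissible as they are
(`finite_support_of_annulus`).

For the geometry, variation of constants shows that `u` lies above each sinusoid that touches it
(`CurvaturePrimitive.sinusoid_le`). In polar coordinates this says that the shape is the interior of
an intersection of half-planes, hence contains the interior of the convex hull of any finite set of
its boundary points and the origin. Between consecutive points of the support `u` is itself a
sinusoid, and that sector of the shape is a triangle with a vertex at the origin. So the shape is a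
polygon near every angle where the support is locally finite (`exists_polygon_of_isolated`), and is a
polygon altogether if the support is finite modulo `2π` (`isConvexPolygon_shape`).
-/

namespace ConvexShape

open Filter Function

/-! ### Lipschitz functions and periodization -/

theorem W1inf.continuous {u : ℝ → ℝ} (hu : W1inf u) : Continuous u :=
  hu.1.choose_spec.continuous

theorem W1inf.periodic {u : ℝ → ℝ} (hu : W1inf u) : Function.Periodic u (2 * Real.pi) := hu.2

theorem periodic_deriv {u : ℝ → ℝ} {T : ℝ} (hu : Function.Periodic u T) :
    Function.Periodic (deriv u) T := by
  intro x
  have h : (fun y => u (y + T)) = u := funext hu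
  conv_rhs => rw [← h]
  rw [deriv_comp_add_const]

theorem W1inf.add {u v : ℝ → ℝ} (hu : W1inf u) (hv : W1inf v) : W1inf (fun θ => u θ + v θ) := by
  obtain ⟨⟨K, hK⟩, hp⟩ := hu
  obtain ⟨⟨L, hL⟩, hq⟩ := hv
  exact ⟨⟨K + L, hK.add hL⟩, fun θ => by simp only [hp θ, hq θ]⟩

theorem W1inf.const_mul {u : ℝ → ℝ} (hu : W1inf u) (c : ℝ) : W1inf (fun θ => c * u θ) := by
  obtain ⟨⟨K, hK⟩, hp⟩ := hu
  refine ⟨⟨‖c‖₊ * K, ?_⟩, fun θ => by simp only [hp θ]⟩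
  exact (lipschitzWith_smul c).comp hK

theorem abs_deriv_le_of_lipschitz {u : ℝ → ℝ} {K : ℝ≥0} (hu : LipschitzWith K u) (x : ℝ) :
    |deriv u x| ≤ K := by
  simpa using norm_deriv_le_of_lipschitz (x₀ := x) hu

/-- Fundamental theorem of calculus for Lipschitz functions. -/
theorem integral_deriv_of_lipschitz {u : ℝ → ℝ} {K : ℝ≥0} (hu : LipschitzWith K u) (a b : ℝ) :
    ∫ x in a..b, deriv u x = u b - u a :=
  hu.lipschitzOnWith.absolutelyContinuousOnInterval.integral_deriv_eq_sub

theorem intervalIntegrable_deriv_of_lipschitz {u : ℝ → ℝ} {K : ℝ≥0} (hu : LipschitzWith K u)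
    (a b : ℝ) : IntervalIntegrable (deriv u) volume a b :=
  hu.lipschitzOnWith.absolutelyContinuousOnInterval.intervalIntegrable_deriv

theorem intervalIntegrable_deriv_mul_deriv {u v : ℝ → ℝ} {K L : ℝ≥0}
    (hu : LipschitzWith K u) (hv : LipschitzWith L v) (a b : ℝ) :
    IntervalIntegrable (fun x => deriv u x * deriv v x) volume a b := by
  have h1 := intervalIntegrable_deriv_of_lipschitz hu a b
  rw [intervalIntegrable_iff] at h1 ⊢
  exact Integrable.mul_bdd (c := L) h1 (measurable_deriv v).aestronglyMeasurable
    (ae_of_all _ fun x => by simpa using abs_deriv_le_of_lipschitz hv x)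

theorem abs_le_of_lipschitz {v : ℝ → ℝ} {L : ℝ≥0} (hv : LipschitzWith L v) {α β : ℝ}
    (hαβ : α ≤ β) (hv0 : ∀ θ, θ ∉ Ioo α β → v θ = 0) (θ : ℝ) : |v θ| ≤ L * (β - α) := by
  by_cases hθ : θ ∈ Ioo α β
  · have := hv.dist_le_mul θ α
    rw [hv0 α fun hm => lt_irrefl _ hm.1, Real.dist_eq, Real.dist_eq, sub_zero,
      abs_of_pos (sub_pos.2 hθ.1)] at this
    refine this.trans (mul_le_mul_of_nonneg_left ?_ L.2)
    linarith [hθ.2]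
  · rw [hv0 θ hθ, abs_zero]
    exact mul_nonneg L.2 (by linarith)

/-- The `2π`-periodic function that agrees with `v` on `[α, α + 2π)`. -/
noncomputable def periodize (α : ℝ) (v : ℝ → ℝ) : ℝ → ℝ :=
  fun θ => v (toIcoMod Real.two_pi_pos α θ)

theorem periodize_periodic (α : ℝ) (v : ℝ → ℝ) :
    Function.Periodic (periodize α v) (2 * Real.pi) := by
  intro θ
  simp only [periodize, toIcoMod_add_right]

/-- A function that vanishes outside `[α, β]`, an interval shorter than a period, is not changed by
periodization on the longer window `(β - 2π, α + 2π)`. -/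
theorem periodize_eq {α β : ℝ} {v : ℝ → ℝ} (hαβ : α ≤ β)
    (h0 : ∀ θ, θ ∉ Icc α β → v θ = 0) {θ : ℝ}
    (hθ : θ ∈ Ioo (β - 2 * Real.pi) (α + 2 * Real.pi)) : periodize α v θ = v θ := by
  unfold periodize
  rcases le_or_gt α θ with h | h
  · rw [(toIcoMod_eq_self Real.two_pi_pos).2 ⟨h, hθ.2⟩]
  · rw [← toIcoMod_add_right Real.two_pi_pos,
      (toIcoMod_eq_self Real.two_pi_pos).2 ⟨by linarith [hθ.1], by linarith⟩,
      h0 θ fun hm => by linarith [hm.1], h0 _ fun hm => by linarith [hm.2, hθ.1]]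

theorem periodize_W1inf {α : ℝ} {v : ℝ → ℝ} {K : ℝ≥0} (hv : LipschitzWith K v)
    (h0 : v α = 0) (h1 : v (α + 2 * Real.pi) = 0) : W1inf (periodize α v) := by
  refine ⟨⟨K, LipschitzWith.of_dist_le_mul ?_⟩, periodize_periodic α v⟩
  suffices H : ∀ x y, x ≤ y → |periodize α v x - periodize α v y| ≤ K * (y - x) by
    intro x y
    rw [Real.dist_eq, Real.dist_eq]
    rcases le_total x y with h | h
    · rw [abs_sub_comm x y, abs_of_nonneg (sub_nonneg.2 h)]
      exact H x y h
    · rw [abs_of_nonneg (sub_nonneg.2 h), abs_sub_comm]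
      exact H y x h
  intro x y hxy
  have hL : ∀ s t, s ≤ t → |v s - v t| ≤ K * (t - s) := fun s t hst => by
    have := hv.dist_le_mul s t
    rwa [Real.dist_eq, Real.dist_eq, abs_sub_comm s t, abs_of_nonneg (sub_nonneg.2 hst)] at this
  have hpi := Real.two_pi_pos
  have hx := toIcoMod_mem_Ico hpi α x
  have hy := toIcoMod_mem_Ico hpi α y
  have ex := toIcoMod_add_toIcoDiv_zsmul hpi α x
  have ey := toIcoMod_add_toIcoDiv_zsmul hpi α y
  unfold periodize
  set x' := toIcoMod hpi α x
  set y' := toIcoMod hpi α y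
  set m := toIcoDiv hpi α x
  set n := toIcoDiv hpi α y
  simp only [zsmul_eq_mul] at ex ey
  rcases lt_trichotomy m n with h | h | h
  · have hmn : (m : ℝ) + 1 ≤ n := by exact_mod_cast h
    have e1 := hL x' (α + 2 * Real.pi) hx.2.le
    have e2 := hL α y' hy.1
    rw [h1] at e1
    rw [h0] at e2
    have hK : (0 : ℝ) ≤ K := K.2
    have : |v x' - v y'| ≤ K * (α + 2 * Real.pi - x') + K * (y' - α) := by
      have := abs_sub_le (v x') 0 (v y')
      linarith
    refine this.trans ?_
    rw [← mul_add]
    refine mul_le_mul_of_nonneg_left ?_ hK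
    nlinarith
  · have h2 : x' ≤ y' := by rw [h] at ex; linarith
    have := hL x' y' h2
    rw [← ex, ← ey, h]
    convert this using 2
    ring
  · exfalso
    have hmn : (n : ℝ) + 1 ≤ m := by exact_mod_cast h
    nlinarith [hx.1, hy.2]

/-! ### Functions with a curvature primitive -/

/-- `g` is a primitive of `u'' + u`: the function `U` is a primitive of `u`, and `g - U` is the
derivative of `u` in the integrated sense. -/
structure CurvaturePrimitive (u U g : ℝ → ℝ) : Prop where
  continuous : Continuous u
  hasDerivAt : ∀ s, HasDerivAt U (u s) s
  intervalIntegrable : ∀ x y, IntervalIntegrable g volume x y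
  sub_eq : ∀ x y, u y - u x = ∫ s in x..y, (g s - U s)

namespace CurvaturePrimitive

variable {u U g : ℝ → ℝ}

theorem continuous_primitive (h : CurvaturePrimitive u U g) : Continuous U :=
  continuous_iff_continuousAt.2 fun s => (h.hasDerivAt s).continuousAt

theorem intervalIntegrable_sub (h : CurvaturePrimitive u U g) (x y : ℝ) :
    IntervalIntegrable (fun s => g s - U s) volume x y :=
  (h.intervalIntegrable x y).sub (h.continuous_primitive.intervalIntegrable x y)

theorem eq_add (h : CurvaturePrimitive u U g) (x : ℝ) :
    u = fun y => u x + ∫ s in x..y, (g s - U s) := by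
  funext y
  rw [← h.sub_eq x y]
  ring

theorem integral_eq (h : CurvaturePrimitive u U g) (x y : ℝ) : ∫ s in x..y, u s = U y - U x :=
  intervalIntegral.integral_eq_sub_of_hasDerivAt (fun s _ => h.hasDerivAt s)
    (h.continuous.intervalIntegrable x y)

theorem stronglyMeasurableAtFilter (h : CurvaturePrimitive u U g) (x : ℝ) (l : Filter ℝ)
    (hl : l ≤ 𝓝 x) : StronglyMeasurableAtFilter (fun s => g s - U s) l := by
  refine ⟨Ioc (x - 1) (x + 1), hl (Ioc_mem_nhds (by linarith) (by linarith)), ?_⟩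
  have := h.intervalIntegrable_sub (x - 1) (x + 1)
  rw [intervalIntegrable_iff, uIoc_of_le (by linarith)] at this
  exact this.aestronglyMeasurable

theorem hasDerivWithinAt_right (h : CurvaturePrimitive u U g) {θ p : ℝ}
    (hg : Tendsto g (𝓝[>] θ) (𝓝 p)) : HasDerivWithinAt u (p - U θ) (Ioi θ) θ := by
  rw [h.eq_add (θ - 1)]
  refine HasDerivWithinAt.const_add _ ?_
  refine hasDerivWithinAt_Ioi_iff_Ici.2 ?_
  refine intervalIntegral.integral_hasDerivWithinAt_of_tendsto_ae_right
    (h.intervalIntegrable_sub _ _)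
    (h.stronglyMeasurableAtFilter θ (𝓝[>] θ) nhdsWithin_le_nhds) ?_
  exact (hg.sub (h.continuous_primitive.continuousAt.tendsto.mono_left
    nhdsWithin_le_nhds)).mono_left inf_le_left

theorem hasDerivWithinAt_left (h : CurvaturePrimitive u U g) {θ p : ℝ}
    (hg : Tendsto g (𝓝[<] θ) (𝓝 p)) : HasDerivWithinAt u (p - U θ) (Iio θ) θ := by
  rw [h.eq_add (θ - 1)]
  refine HasDerivWithinAt.const_add _ ?_
  refine hasDerivWithinAt_Iio_iff_Iic.2 ?_
  have hev : 𝓝[≤] θ ⊓ ae volume ≤ 𝓝[<] θ := by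
    have h1 : ({θ}ᶜ : Set ℝ) ∈ ae (volume : Measure ℝ) := compl_mem_ae_iff.2 (by simp)
    intro s hs
    rw [mem_nhdsWithin_iff_eventually] at hs
    refine mem_inf_iff_superset.2 ⟨Iic θ ∩ {x | x ∈ Iio θ → x ∈ s}, ?_, {θ}ᶜ, h1, ?_⟩
    · exact inter_mem self_mem_nhdsWithin (nhdsWithin_le_nhds hs)
    · rintro x ⟨⟨hx1, hx2⟩, hx3⟩
      exact hx2 (lt_of_le_of_ne hx1 hx3)
  refine intervalIntegral.integral_hasDerivWithinAt_of_tendsto_ae_right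
    (h.intervalIntegrable_sub _ _)
    (h.stronglyMeasurableAtFilter θ (𝓝[≤] θ) nhdsWithin_le_nhds) ?_
  exact (hg.sub (h.continuous_primitive.continuousAt.tendsto.mono_left
    nhdsWithin_le_nhds)).mono_left hev

theorem hasDerivAt_of_continuousAt (h : CurvaturePrimitive u U g) {θ : ℝ}
    (hg : ContinuousAt g θ) : HasDerivAt u (g θ - U θ) θ := by
  rw [h.eq_add (θ - 1)]
  refine HasDerivAt.const_add _ ?_
  exact intervalIntegral.integral_hasDerivAt_right (h.intervalIntegrable_sub _ _)
    (h.stronglyMeasurableAtFilter θ (𝓝 θ) le_rfl) (hg.sub h.continuous_primitive.continuousAt)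

end CurvaturePrimitive

/-! ### From the weak inequality to a monotone curvature primitive -/

/-- The weak inequality `u'' + u ≥ 0`, tested with a hat function of half-width `ε` centred at `y`,
bounds the second difference of `u + U₂` at `y`, where `U₂'' = u`. -/
theorem ConvexityConstraint.second_difference {u U U₂ : ℝ → ℝ} (hu : W1inf u)
    (hc : ConvexityConstraint u) (hU : ∀ s, HasDerivAt U (u s) s)
    (hU₂ : ∀ s, HasDerivAt U₂ (U s) s) {y ε : ℝ} (hε : 0 < ε) (hεπ : ε < Real.pi) :
    2 * (u y + U₂ y) ≤ (u (y - ε) + U₂ (y - ε)) + (u (y + ε) + U₂ (y + ε)) := by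
  set α := y - ε with hα
  set β := y + ε with hβ
  set v : ℝ → ℝ := fun θ => max (ε - |θ - y|) 0 with hv
  have hvL : LipschitzWith 1 v := by
    refine LipschitzWith.of_dist_le_mul fun s t => ?_
    simp only [Real.dist_eq, hv, NNReal.coe_one, one_mul]
    refine (abs_max_sub_max_le_abs _ _ _).trans ?_
    rw [show ε - |s - y| - (ε - |t - y|) = |t - y| - |s - y| by ring, abs_sub_comm s t]
    refine (abs_abs_sub_abs_le_abs_sub _ _).trans (le_of_eq ?_)
    congr 1
    ring
  have hpi := Real.pi_pos
  have hv0 : ∀ θ, θ ∉ Icc α β → v θ = 0 := by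
    intro θ hθ
    simp only [hv]
    refine max_eq_right ?_
    by_contra hlt
    push Not at hlt
    have := abs_lt.1 (show |θ - y| < ε by linarith)
    exact hθ ⟨by linarith [this.1], by linarith [this.2]⟩
  have hvl : ∀ θ ∈ Icc α y, v θ = θ - α := by
    intro θ hθ
    simp only [hv]
    rw [abs_of_nonpos (by linarith [hθ.2]), max_eq_left (by linarith [hθ.1])]
    linarith
  have hvr : ∀ θ ∈ Icc y β, v θ = β - θ := by
    intro θ hθ
    simp only [hv]
    rw [abs_of_nonneg (by linarith [hθ.1]), max_eq_left (by linarith [hθ.2])]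
    linarith
  set w := periodize α v with hw
  have hwW : W1inf w := periodize_W1inf hvL
    (by rw [hvl α ⟨le_rfl, by linarith⟩, sub_self]) (hv0 _ fun h => by linarith [h.2])
  have hwv : ∀ θ ∈ Ioo (β - 2 * Real.pi) (α + 2 * Real.pi), w θ = v θ := fun θ hθ =>
    periodize_eq (by linarith) hv0 hθ
  obtain ⟨K, hK⟩ := hu.1
  obtain ⟨L, hL⟩ := hwW.1
  set F : ℝ → ℝ := fun θ => u θ * w θ - deriv u θ * deriv w θ with hF
  have hFint : ∀ s t, IntervalIntegrable F volume s t := fun s t =>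
    ((hu.continuous.mul hwW.continuous).intervalIntegrable s t).sub
      (intervalIntegrable_deriv_mul_deriv hK hL s t)
  have hFper : Function.Periodic F (2 * Real.pi) := fun θ => by
    simp only [hF, hu.periodic θ, hwW.periodic θ, periodic_deriv hu.periodic θ,
      periodic_deriv hwW.periodic θ]
  have h0 : 0 ≤ ∫ θ in α..α + 2 * Real.pi, F θ := by
    have := hc w hwW (fun θ => le_max_right _ _)
    rwa [← hFper.intervalIntegral_add_eq 0 α, zero_add]
  have huc := hu.continuous
  have c1 : Continuous fun θ => (θ - α) * u θ := by fun_prop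
  have c2 : Continuous fun θ => (β - θ) * u θ := by fun_prop
  have I1 : ∫ θ in α..y, F θ = (ε * U y - U₂ y + U₂ α) - (u y - u α) := by
    rw [intervalIntegral.integral_congr_Ioo_of_le (g := fun θ => (θ - α) * u θ - deriv u θ)
      (by linarith)]
    · rw [intervalIntegral.integral_sub
        (c1.intervalIntegrable _ _)
        (intervalIntegrable_deriv_of_lipschitz hK _ _), integral_deriv_of_lipschitz hK,
        intervalIntegral.integral_eq_sub_of_hasDerivAt (f := fun θ => (θ - α) * U θ - U₂ θ)]
      · rw [hα]; ring
      · intro θ _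
        exact ((((hasDerivAt_id θ).sub_const α).mul (hU θ)).sub (hU₂ θ)).congr_deriv
          (by simp only [id]; ring)
      · exact c1.intervalIntegrable _ _
    · intro θ hθ
      have e1 : w =ᶠ[𝓝 θ] fun s => s - α := by
        filter_upwards [Ioo_mem_nhds hθ.1 hθ.2] with s hs
        rw [hwv s ⟨by linarith [hs.1], by linarith [hs.2]⟩, hvl s ⟨hs.1.le, hs.2.le⟩]
      simp only [hF, e1.eq_of_nhds, e1.deriv_eq]
      rw [((hasDerivAt_id' θ).sub_const α).deriv]
      ring
  have I2 : ∫ θ in y..β, F θ = (U₂ β - ε * U y - U₂ y) + (u β - u y) := by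
    rw [intervalIntegral.integral_congr_Ioo_of_le (g := fun θ => (β - θ) * u θ + deriv u θ)
      (by linarith)]
    · rw [intervalIntegral.integral_add
        (c2.intervalIntegrable _ _)
        (intervalIntegrable_deriv_of_lipschitz hK _ _), integral_deriv_of_lipschitz hK,
        intervalIntegral.integral_eq_sub_of_hasDerivAt (f := fun θ => (β - θ) * U θ + U₂ θ)]
      · rw [hβ]; ring
      · intro θ _
        exact ((((hasDerivAt_id θ).const_sub β).mul (hU θ)).add (hU₂ θ)).congr_deriv
          (by simp only [id]; ring)
      · exact c2.intervalIntegrable _ _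
    · intro θ hθ
      have e1 : w =ᶠ[𝓝 θ] fun s => β - s := by
        filter_upwards [Ioo_mem_nhds hθ.1 hθ.2] with s hs
        rw [hwv s ⟨by linarith [hs.1], by linarith [hs.2]⟩, hvr s ⟨hs.1.le, hs.2.le⟩]
      simp only [hF, e1.eq_of_nhds, e1.deriv_eq]
      rw [((hasDerivAt_id' θ).const_sub β).deriv]
      ring
  have I3 : ∫ θ in β..α + 2 * Real.pi, F θ = 0 := by
    rw [intervalIntegral.integral_congr_Ioo_of_le (g := fun _ => (0 : ℝ)) (by linarith)]
    · simp
    · intro θ hθ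
      have e1 : w =ᶠ[𝓝 θ] fun _ => 0 := by
        filter_upwards [Ioo_mem_nhds hθ.1 hθ.2] with s hs
        rw [hwv s ⟨by linarith [hs.1], by linarith [hs.2]⟩, hv0 s fun hm => by
          linarith [hm.2, hs.1]]
      simp only [hF, e1.eq_of_nhds, e1.deriv_eq, deriv_const]
      ring
  rw [← intervalIntegral.integral_add_adjacent_intervals (hFint α y) (hFint y _),
    ← intervalIntegral.integral_add_adjacent_intervals (hFint y β) (hFint β _), I1, I2, I3] at h0
  linarith

/-- A continuous function that is midpoint convex at small scales is convex. -/
theorem convexOn_of_midpoint {f : ℝ → ℝ} (hf : Continuous f) {ε₀ : ℝ} (hε₀ : 0 < ε₀)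
    (h : ∀ y ε, 0 < ε → ε < ε₀ → 2 * f y ≤ f (y - ε) + f (y + ε)) : ConvexOn ℝ univ f := by
  refine LinearOrder.convexOn_of_lt convex_univ ?_
  intro x _ z _ hxz a b ha hb hab
  set m := (f z - f x) / (z - x) with hm
  have hzx : (0 : ℝ) < z - x := sub_pos.2 hxz
  have hmz : m * (z - x) = f z - f x := div_mul_cancel₀ _ hzx.ne'
  set g : ℝ → ℝ := fun t => f t - (f x + m * (t - x)) with hg
  have hgc : Continuous g := by fun_prop
  suffices H : ∀ t ∈ Icc x z, g t ≤ 0 by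
    have ht : a • x + b • z ∈ Icc x z := by
      simp only [smul_eq_mul]
      obtain rfl : a = 1 - b := by linarith
      constructor <;> nlinarith
    have := H _ ht
    simp only [hg, smul_eq_mul] at this ⊢
    obtain rfl : a = 1 - b := by linarith
    have e : m * ((1 - b) * x + b * z - x) = b * (f z - f x) := by rw [← hmz]; ring
    rw [e] at this
    linarith
  by_contra hcon
  push Not at hcon
  obtain ⟨t₀, ht₀, hpos⟩ := hcon
  obtain ⟨y₀, hy₀, hmax⟩ := isCompact_Icc.exists_isMaxOn ⟨t₀, ht₀⟩ hgc.continuousOn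
  have hA : IsCompact (Icc x z ∩ g ⁻¹' {g y₀}) :=
    isCompact_Icc.inter_right (isClosed_singleton.preimage hgc)
  -- at the first point where the maximum is attained, the midpoint inequality fails
  obtain ⟨y, ⟨hy, hyM⟩, hleast⟩ := hA.exists_isLeast ⟨y₀, hy₀, rfl⟩
  have hyM : g y = g y₀ := hyM
  have hMpos : 0 < g y := hyM ▸ hpos.trans_le (hmax ht₀)
  have hxy : x < y := lt_of_le_of_ne hy.1 fun e => by
    rw [← e] at hMpos; simp [hg] at hMpos
  have hyz : y < z := lt_of_le_of_ne hy.2 fun e => by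
    rw [e] at hMpos; simp only [hg, hmz] at hMpos; linarith
  set ε := min (ε₀ / 2) (min (y - x) (z - y)) with hε
  have hε1 : 0 < ε := lt_min (by linarith) (lt_min (by linarith) (by linarith))
  have hε2 : ε ≤ ε₀ / 2 := min_le_left _ _
  have hε3 : ε ≤ y - x := (min_le_right _ _).trans (min_le_left _ _)
  have hε4 : ε ≤ z - y := (min_le_right _ _).trans (min_le_right _ _)
  have key := h y ε hε1 (by linarith)
  have m1 : y - ε ∈ Icc x z := ⟨by linarith, by linarith⟩
  have m2 : y + ε ∈ Icc x z := ⟨by linarith, by linarith⟩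
  have g1 : g (y - ε) ≤ g y₀ := hmax m1
  have g2 : g (y + ε) ≤ g y₀ := hmax m2
  have key' : 2 * g y ≤ g (y - ε) + g (y + ε) := by simp only [hg]; linarith
  have : y ≤ y - ε := hleast ⟨m1, show g (y - ε) = g y₀ by linarith⟩
  linarith

/-- A function with `u'' + u ≥ 0` has a monotone right-continuous curvature primitive: it is the
right derivative of the convex function `u + U₂`, where `U₂'' = u`. -/
theorem ConvexityConstraint.exists_stieltjes {u : ℝ → ℝ} (hu : W1inf u)
    (hc : ConvexityConstraint u) :
    ∃ (U : ℝ → ℝ) (H : StieltjesFunction ℝ), CurvaturePrimitive u U H := by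
  set U : ℝ → ℝ := fun s => ∫ r in (0 : ℝ)..s, u r with hUdef
  have hU : ∀ s, HasDerivAt U (u s) s := fun s => hu.continuous.integral_hasStrictDerivAt 0 s
    |>.hasDerivAt
  have hUc : Continuous U := continuous_iff_continuousAt.2 fun s => (hU s).continuousAt
  set U₂ : ℝ → ℝ := fun s => ∫ r in (0 : ℝ)..s, U r with hU₂def
  have hU₂ : ∀ s, HasDerivAt U₂ (U s) s := fun s => hUc.integral_hasStrictDerivAt 0 s
    |>.hasDerivAt
  have hU₂c : Continuous U₂ := continuous_iff_continuousAt.2 fun s => (hU₂ s).continuousAt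
  have hconv : ConvexOn ℝ univ (fun s => u s + U₂ s) :=
    convexOn_of_midpoint (hu.continuous.add hU₂c) Real.pi_pos
      fun y ε h1 h2 => hc.second_difference hu hU hU₂ h1 h2
  set W : ℝ → ℝ := fun s => u s + U₂ s with hW
  set D : ℝ → ℝ := fun x => derivWithin W (Ioi x) x with hD
  have hDW : ∀ x, HasDerivWithinAt W (D x) (Ioi x) x := fun x =>
    hconv.hasDerivWithinAt_rightDeriv_of_mem_interior (by simp)
  have hDm : Monotone D := by
    have := hconv.monotoneOn_rightDeriv
    rwa [interior_univ, monotoneOn_univ] at this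
  refine ⟨U, hDm.stieltjesFunction, hu.continuous, hU,
    fun x y => (hDm.stieltjesFunction.mono.monotoneOn _).intervalIntegrable, fun x y => ?_⟩
  have hint : ∫ s in x..y, D s = W y - W x :=
    intervalIntegral.integral_eq_sub_of_hasDeriv_right (hu.continuous.add hU₂c).continuousOn
      (fun s _ => hDW s) (hDm.monotoneOn _).intervalIntegrable
  have hae : ∫ s in x..y, hDm.stieltjesFunction s = ∫ s in x..y, D s := by
    refine intervalIntegral.integral_congr_ae ?_
    filter_upwards [compl_mem_ae_iff.2 (hDm.countable_not_continuousAt.measure_zero volume)]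
      with s hs _
    have hs : ContinuousAt D s := by simpa using hs
    rw [hDm.stieltjesFunction_eq]
    exact hs.continuousWithinAt.rightLim_eq
  rw [intervalIntegral.integral_sub (hDm.stieltjesFunction.mono.monotoneOn _).intervalIntegrable
    (hUc.intervalIntegrable _ _), hae, hint,
    intervalIntegral.integral_eq_sub_of_hasDerivAt (fun s _ => hU₂ s) (hUc.intervalIntegrable _ _)]
  simp only [hW]
  ring

theorem stieltjes_tendsto_right (H : StieltjesFunction ℝ) (θ : ℝ) : Tendsto H (𝓝[>] θ) (𝓝 (H θ)) :=
  (H.right_continuous θ).tendsto.mono_left (nhdsWithin_mono _ Ioi_subset_Ici_self)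

namespace CurvaturePrimitive

variable {u U : ℝ → ℝ} {H : StieltjesFunction ℝ}

theorem hasDerivWithinAt_Ioi (h : CurvaturePrimitive u U H) (θ : ℝ) :
    HasDerivWithinAt u (H θ - U θ) (Ioi θ) θ :=
  h.hasDerivWithinAt_right (stieltjes_tendsto_right H θ)

theorem hasDerivWithinAt_Iio (h : CurvaturePrimitive u U H) (θ : ℝ) :
    HasDerivWithinAt u (leftLim H θ - U θ) (Iio θ) θ :=
  h.hasDerivWithinAt_left (H.mono.tendsto_leftLim θ)

theorem ae_hasDerivAt (h : CurvaturePrimitive u U H) :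
    ∀ᵐ θ, HasDerivAt u (H θ - U θ) θ := by
  filter_upwards [compl_mem_ae_iff.2 (H.mono.countable_not_continuousAt.measure_zero volume)]
    with θ hθ
  exact h.hasDerivAt_of_continuousAt (by simpa using hθ)

end CurvaturePrimitive

/-! ### The curvature measure -/

/-- Integration by parts against a Stieltjes measure. -/
theorem integral_stieltjes (H : StieltjesFunction ℝ) {φ : ℝ → ℝ} (hφ : ContDiff ℝ 1 φ)
    {a b : ℝ} (hab : a ≤ b) (h0 : ∀ x, x ∉ Ioo a b → φ x = 0) :
    ∫ x, φ x ∂H.measure = -∫ s in a..b, H s * deriv φ s := by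
  have hφ' : Continuous (deriv φ) := hφ.continuous_deriv le_rfl
  have ha : φ a = 0 := h0 a fun h => lt_irrefl _ h.1
  have hb : φ b = 0 := h0 b fun h => lt_irrefl _ h.2
  have hftc : ∀ x, ∫ s in x..b, deriv φ s = -φ x := fun x => by
    rw [intervalIntegral.integral_deriv_eq_sub
      (fun s _ => (hφ.differentiable one_ne_zero) s) (hφ'.intervalIntegrable _ _), hb, zero_sub]
  rw [← setIntegral_eq_integral_of_forall_compl_eq_zero (s := Ioc a b) fun x hx =>
    h0 x fun h => hx ⟨h.1, h.2.le⟩]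
  have e1 : ∫ x in Ioc a b, φ x ∂H.measure =
      -∫ x in Ioc a b, (∫ s in Ioc a b, (Ici x).indicator (deriv φ) s) ∂H.measure := by
    rw [← integral_neg]
    refine setIntegral_congr_fun measurableSet_Ioc fun x hx => ?_
    rw [setIntegral_indicator measurableSet_Ici]
    have : Ioc a b ∩ Ici x = Icc x b := by
      ext s
      simp only [mem_inter_iff, mem_Ioc, mem_Ici, mem_Icc]
      exact ⟨fun h => ⟨h.2, h.1.2⟩, fun h => ⟨⟨hx.1.trans_le h.1, h.2⟩, h.1⟩⟩
    rw [this, integral_Icc_eq_integral_Ioc, ← intervalIntegral.integral_of_le hx.2, hftc, neg_neg]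
  obtain ⟨C, hC⟩ := isCompact_Icc.exists_bound_of_continuousOn (s := Icc a b) hφ'.continuousOn
  have : IsFiniteMeasure (H.measure.restrict (Ioc a b)) :=
    ⟨by simp [H.measure_Ioc]⟩
  have hmeas : Measurable (fun p : ℝ × ℝ => (Ici p.1).indicator (deriv φ) p.2) := by
    have : (fun p : ℝ × ℝ => (Ici p.1).indicator (deriv φ) p.2) =
        {p : ℝ × ℝ | p.1 ≤ p.2}.indicator (fun p => deriv φ p.2) := by
      ext p
      simp [indicator]
    rw [this]
    exact (hφ'.measurable.comp measurable_snd).indicator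
      (measurableSet_le measurable_fst measurable_snd)
  have hint : Integrable (uncurry fun x s => (Ici x).indicator (deriv φ) s)
      ((H.measure.restrict (Ioc a b)).prod (volume.restrict (Ioc a b))) := by
    refine Integrable.of_bound (C := C) hmeas.aestronglyMeasurable ?_
    rw [Measure.prod_restrict]
    refine (ae_restrict_mem (measurableSet_Ioc.prod measurableSet_Ioc)).mono fun p hp => ?_
    have hp2 := hC p.2 (Ioc_subset_Icc_self hp.2)
    refine le_trans ?_ hp2
    exact norm_indicator_le_norm_self _ _
  rw [e1, integral_integral_swap hint]
  congr 1
  have e2 : ∫ s in a..b, H s * deriv φ s = ∫ s in a..b, (H s - H a) * deriv φ s := by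
    have hH : IntervalIntegrable (fun s => H s * deriv φ s) volume a b :=
      ((H.mono.monotoneOn _).intervalIntegrable).mul_continuousOn hφ'.continuousOn
    simp only [sub_mul]
    rw [intervalIntegral.integral_sub hH ((hφ'.const_mul _).intervalIntegrable _ _),
      intervalIntegral.integral_const_mul, hftc, ha]
    simp
  rw [e2, intervalIntegral.integral_of_le hab]
  refine setIntegral_congr_fun measurableSet_Ioc fun s hs => ?_
  have : (fun x => (Ici x).indicator (deriv φ) s) =
      (Iic s).indicator (fun _ => deriv φ s) := by
    ext x
    simp [indicator]
  rw [this, setIntegral_indicator measurableSet_Iic]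
  have : Ioc a b ∩ Iic s = Ioc a s := by
    ext x
    simp only [mem_inter_iff, mem_Ioc, mem_Iic]
    exact ⟨fun h => ⟨h.1.1, h.2⟩, fun h => ⟨⟨h.1, h.2.trans hs.2⟩, h.2⟩⟩
  rw [this, setIntegral_const, smul_eq_mul, measureReal_def, H.measure_Ioc,
    ENNReal.toReal_ofReal (sub_nonneg.2 (H.mono hs.1.le))]

theorem CurvaturePrimitive.isCurvatureMeasure {u U : ℝ → ℝ} {H : StieltjesFunction ℝ}
    (h : CurvaturePrimitive u U H) : IsCurvatureMeasure u H.measure := by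
  refine ⟨inferInstance, fun φ hφ hcs => ?_⟩
  obtain ⟨R, hR0, hR⟩ := hcs.isCompact.isBounded.subset_ball_lt 0 0
  rw [Real.ball_eq_Ioo, zero_sub, zero_add] at hR
  have h0 : ∀ x, x ∉ Ioo (-R) R → φ x = 0 := fun x hx =>
    image_eq_zero_of_notMem_tsupport fun hm => hx (hR hm)
  have h0' : ∀ x, x ∉ Ioo (-R) R → deriv φ x = 0 := fun x hx =>
    image_eq_zero_of_notMem_tsupport fun hm => hx (hR
      (closure_minimal support_deriv_subset isClosed_closure hm))
  have h0'' : ∀ x, x ∉ Ioo (-R) R → deriv (deriv φ) x = 0 := fun x hx => by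
    refine image_eq_zero_of_notMem_tsupport fun hm => hx (hR ?_)
    have h1 : tsupport (deriv (deriv φ)) ⊆ tsupport (deriv φ) :=
      closure_minimal support_deriv_subset isClosed_closure
    have h2 : tsupport (deriv φ) ⊆ tsupport φ :=
      closure_minimal support_deriv_subset isClosed_closure
    exact h2 (h1 hm)
  have hφ1 : ContDiff ℝ ∞ (deriv φ) := by
    have := (contDiff_infty_iff_deriv (𝕜 := ℝ)).1 hφ
    exact this.2
  have hd1 : Differentiable ℝ φ := hφ.differentiable (by simp)
  have hd2 : Differentiable ℝ (deriv φ) := hφ1.differentiable (by simp)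
  have hc2 : Continuous (deriv (deriv φ)) := hφ1.continuous_deriv (by simp)
  rw [integral_stieltjes H (hφ.of_le (by simp)) (by linarith : -R ≤ R) h0,
    ← intervalIntegral.integral_eq_integral_of_support_subset (a := -R) (b := R)]
  · have hHi : IntervalIntegrable (fun s => H s * deriv φ s) volume (-R) R :=
      (h.intervalIntegrable _ _).mul_continuousOn hd2.continuous.continuousOn
    have hui : Continuous fun s => u s * (deriv (deriv φ) s + φ s) :=
      h.continuous.mul (hc2.add hd1.continuous)
    have key := intervalIntegral.integral_eq_sub_of_hasDeriv_right (a := -R) (b := R)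
      (f := fun s => u s * deriv φ s + U s * φ s)
      (f' := fun s => H s * deriv φ s + u s * (deriv (deriv φ) s + φ s))
      ((h.continuous.mul hd2.continuous).add
        (h.continuous_primitive.mul hd1.continuous)).continuousOn
      (fun s _ => by
        refine (((h.hasDerivWithinAt_Ioi s).mul (hd2 s).hasDerivAt.hasDerivWithinAt).add
          ((h.hasDerivAt s).hasDerivWithinAt.mul
            (hd1 s).hasDerivAt.hasDerivWithinAt)).congr_deriv ?_
        ring)
      (hHi.add (hui.intervalIntegrable _ _))
    rw [intervalIntegral.integral_add hHi (hui.intervalIntegrable _ _),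
      h0 R fun hm => lt_irrefl _ hm.2, h0 (-R) fun hm => lt_irrefl _ hm.1,
      h0' R fun hm => lt_irrefl _ hm.2, h0' (-R) fun hm => lt_irrefl _ hm.1] at key
    linarith
  · intro x hx
    by_contra hn
    have hn' : x ∉ Ioo (-R) R := fun hm => hn ⟨hm.1, hm.2.le⟩
    exact hx (by simp [h0 x hn', h0'' x hn'])

theorem stieltjes_lt_of_mem_support {H : StieltjesFunction ℝ} {x p y : ℝ}
    (hp : p ∈ H.measure.support) (hx : x < p) (hy : p < y) : H x < H y := by
  have := (Measure.mem_support_iff_forall p).1 hp (Ioc x y) (Ioc_mem_nhds hx hy)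
  rw [H.measure_Ioc, ENNReal.ofReal_pos] at this
  linarith

theorem stieltjes_eq_of_inter_support_eq_empty {H : StieltjesFunction ℝ} {α β s : ℝ}
    (h : H.measure.support ∩ Ioo α β = ∅) (h1 : α ≤ s) (h2 : s < β) : H s = H α := by
  refine le_antisymm ?_ (H.mono h1)
  have hle : H.measure (Ioc α s) ≤ H.measure (H.measure.support)ᶜ :=
    measure_mono fun x hx hm => by
      have : x ∈ H.measure.support ∩ Ioo α β := ⟨hm, hx.1, hx.2.trans_lt h2⟩
      rw [h] at this
      exact this
  rw [Measure.measure_compl_support, H.measure_Ioc] at hle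
  have := ENNReal.ofReal_eq_zero.1 (le_antisymm hle zero_le)
  linarith

/-! ### Sufficient condition for the weak inequality -/

/-- If the derivative `k` of `u` satisfies `k θ - k (θ - ε) + ∫_{θ-ε}^θ u ≥ 0` for small `ε`, then
`u'' + u ≥ 0`. The derivative of the test function is replaced by a difference quotient, which is
moved to `k` by a translation. -/
theorem convexityConstraint_of_increments {u k : ℝ → ℝ} (hu : W1inf u) {c ε₀ : ℝ} (hε₀ : 0 < ε₀)
    (hk : ∀ᵐ θ, θ ∈ Ioo (c - ε₀) (c + 2 * Real.pi) → deriv u θ = k θ)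
    (hinc : ∀ θ ∈ Ioo c (c + 2 * Real.pi), ∀ ε ∈ Ioo 0 ε₀,
      -∫ s in (θ - ε)..θ, u s ≤ k θ - k (θ - ε)) : ConvexityConstraint u := by
  intro w hw hw0
  obtain ⟨K, hK⟩ := hu.1
  obtain ⟨L, hL⟩ := hw.1
  have hpi := Real.two_pi_pos
  have huc := hu.continuous
  have hwc := hw.continuous
  have hFper : Function.Periodic (fun θ => u θ * w θ - deriv u θ * deriv w θ) (2 * Real.pi) :=
    fun θ => by
      simp only [hu.periodic θ, hw.periodic θ, periodic_deriv hu.periodic θ,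
        periodic_deriv hw.periodic θ]
  rw [← zero_add (2 * Real.pi), hFper.intervalIntegral_add_eq 0 c]
  set q : ℝ → ℝ → ℝ := fun ε θ => u θ * w θ - deriv u θ * (ε⁻¹ * (w (θ + ε) - w θ)) with hq
  have hlim : Tendsto (fun ε => ∫ θ in c..c + 2 * Real.pi, q ε θ) (𝓝[>] 0)
      (𝓝 (∫ θ in c..c + 2 * Real.pi, (u θ * w θ - deriv u θ * deriv w θ))) := by
    refine intervalIntegral.tendsto_integral_filter_of_dominated_convergence
      (fun θ => |u θ * w θ| + K * L) ?_ ?_ ?_ ?_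
    · refine Eventually.of_forall fun ε => Measurable.aestronglyMeasurable ?_
      have := measurable_deriv u
      have := huc.measurable
      have := hwc.measurable
      fun_prop
    · filter_upwards [self_mem_nhdsWithin] with ε hε
      refine ae_of_all _ fun θ _ => ?_
      have hε : 0 < ε := hε
      have h1 : |ε⁻¹ * (w (θ + ε) - w θ)| ≤ L := by
        have := hL.dist_le_mul (θ + ε) θ
        rw [Real.dist_eq, Real.dist_eq, add_sub_cancel_left, abs_of_pos hε] at this
        rw [abs_mul, abs_of_pos (inv_pos.2 hε), inv_mul_le_iff₀ hε, mul_comm ε]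
        exact this
      rw [Real.norm_eq_abs]
      refine (abs_sub _ _).trans ?_
      rw [abs_mul (deriv u θ)]
      gcongr
      exact abs_deriv_le_of_lipschitz hK θ
    · exact (((huc.mul hwc).abs).add continuous_const).intervalIntegrable _ _
    · filter_upwards [hL.ae_differentiableAt] with θ hθ _
      have := hθ.hasDerivAt.tendsto_slope_zero_right
      exact tendsto_const_nhds.sub (tendsto_const_nhds.mul (by simpa using this))
  have hlow : ∀ᶠ ε in 𝓝[>] (0 : ℝ), -ε * (K * ∫ θ in c..c + 2 * Real.pi, w θ) ≤
      ∫ θ in c..c + 2 * Real.pi, q ε θ := by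
    filter_upwards [Ioo_mem_nhdsGT hε₀] with ε hε
    have hiuw : ∀ a b, IntervalIntegrable (fun θ => u θ * w θ) volume a b :=
      fun a b => (huc.mul hwc).intervalIntegrable a b
    have hi1 : ∀ a b, IntervalIntegrable (fun θ => deriv u θ * w (θ + ε)) volume a b := fun a b =>
      (intervalIntegrable_deriv_of_lipschitz hK a b).mul_continuousOn
        (hwc.comp (continuous_id.add continuous_const)).continuousOn
    have hi2 : ∀ a b, IntervalIntegrable (fun θ => deriv u θ * w θ) volume a b := fun a b =>
      (intervalIntegrable_deriv_of_lipschitz hK a b).mul_continuousOn hwc.continuousOn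
    have hi3 : ∀ a b, IntervalIntegrable (fun θ => deriv u (θ - ε) * w θ) volume a b :=
      fun a b => by
        have := (intervalIntegrable_deriv_of_lipschitz hK (a - ε) (b - ε)).comp_sub_right ε
        simp only [sub_add_cancel] at this
        exact this.mul_continuousOn hwc.continuousOn
    have hshift : ∫ θ in c..c + 2 * Real.pi, deriv u θ * w (θ + ε) =
        ∫ θ in c..c + 2 * Real.pi, deriv u (θ - ε) * w θ := by
      have hp : Function.Periodic (fun θ => deriv u (θ - ε) * w θ) (2 * Real.pi) := fun θ => by
        simp only [hw.periodic θ]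
        rw [add_sub_right_comm, periodic_deriv hu.periodic]
      rw [hp.intervalIntegral_add_eq c (c + ε)]
      have := intervalIntegral.integral_comp_add_right (a := c) (b := c + 2 * Real.pi)
        (fun θ => deriv u (θ - ε) * w θ) ε
      simp only [add_sub_cancel_right] at this
      rw [this]
      congr 1
      ring
    have hqe : ∫ θ in c..c + 2 * Real.pi, q ε θ =
        ∫ θ in c..c + 2 * Real.pi,
          (u θ * w θ + ε⁻¹ * (deriv u θ * w θ - deriv u (θ - ε) * w θ)) := by
      rw [intervalIntegral.integral_add (hiuw _ _) (((hi2 _ _).sub (hi3 _ _)).const_mul _),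
        intervalIntegral.integral_const_mul, intervalIntegral.integral_sub (hi2 _ _) (hi3 _ _),
        ← hshift, ← intervalIntegral.integral_sub (hi2 _ _) (hi1 _ _),
        ← intervalIntegral.integral_const_mul,
        ← intervalIntegral.integral_add (hiuw _ _) (((hi2 _ _).sub (hi1 _ _)).const_mul _)]
      refine intervalIntegral.integral_congr fun θ _ => ?_
      simp only [hq]
      ring
    rw [hqe, neg_mul, ← mul_assoc, ← neg_mul, ← intervalIntegral.integral_const_mul]
    refine intervalIntegral.integral_mono_ae_restrict (by linarith)
      ((hwc.const_mul _).intervalIntegrable _ _)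
      ((hiuw _ _).add (((hi2 _ _).sub (hi3 _ _)).const_mul _)) ?_
    have hk' : ∀ᵐ θ, θ - ε ∈ Ioo (c - ε₀) (c + 2 * Real.pi) → deriv u (θ - ε) = k (θ - ε) :=
      (measurePreserving_sub_right volume ε).quasiMeasurePreserving.ae hk
    refine (ae_restrict_iff' measurableSet_Icc).2 ?_
    filter_upwards [hk, hk', compl_mem_ae_iff.2 (show volume {c} = 0 by simp),
      compl_mem_ae_iff.2 (show volume {c + 2 * Real.pi} = 0 by simp)] with θ h1 h2 h3 h4 hθ
    have hθ' : θ ∈ Ioo c (c + 2 * Real.pi) :=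
      ⟨lt_of_le_of_ne hθ.1 fun e => h3 e.symm, lt_of_le_of_ne hθ.2 h4⟩
    rw [h1 ⟨by linarith [hθ'.1], hθ'.2⟩, h2 ⟨by linarith [hθ'.1, hε.2], by linarith [hθ'.2, hε.1]⟩]
    have hi := hinc θ hθ' ε hε
    have hav : ∫ s in (θ - ε)..θ, u s ≤ ε * (u θ + K * ε) := by
      have : ∫ s in (θ - ε)..θ, u s ≤ ∫ s in (θ - ε)..θ, (u θ + K * ε) := by
        refine intervalIntegral.integral_mono_on (by linarith [hε.1])
          (huc.intervalIntegrable _ _) (by simp) fun s hs => ?_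
        have := hK.dist_le_mul s θ
        rw [Real.dist_eq, Real.dist_eq, abs_sub_comm s θ,
          abs_of_nonneg (a := θ - s) (by linarith [hs.2])] at this
        have h5 := (abs_le.1 this).2
        have : (K : ℝ) * (θ - s) ≤ K * ε := by
          refine mul_le_mul_of_nonneg_left ?_ K.2
          linarith [hs.1]
        linarith
      refine this.trans (le_of_eq ?_)
      rw [intervalIntegral.integral_const, smul_eq_mul]
      ring
    have hε0 : 0 < ε := hε.1
    have h6 : 0 ≤ u θ + ε⁻¹ * (k θ - k (θ - ε)) + K * ε := by
      have : -(u θ + K * ε) ≤ ε⁻¹ * (k θ - k (θ - ε)) := by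
        rw [le_inv_mul_iff₀ hε0]
        linarith
      linarith
    have := mul_nonneg h6 (hw0 θ)
    nlinarith
  have hlim0 : Tendsto (fun ε : ℝ => -ε * (K * ∫ θ in c..c + 2 * Real.pi, w θ)) (𝓝[>] 0) (𝓝 0) := by
    have : Tendsto (fun ε : ℝ => -ε * (K * ∫ θ in c..c + 2 * Real.pi, w θ)) (𝓝 0)
        (𝓝 (-0 * (K * ∫ θ in c..c + 2 * Real.pi, w θ))) :=
      (tendsto_id.neg).mul_const _
    rw [neg_zero, zero_mul] at this
    exact this.mono_left nhdsWithin_le_nhds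
  exact le_of_tendsto_of_tendsto hlim0 hlim hlow

/-! ### Perturbations that keep the convexity constraint in both directions -/

/-- The solution of `v'' + v = g'` with `v = v' - g = 0` at `α`, by variation of constants. -/
noncomputable def oscillator (α : ℝ) (g : ℝ → ℝ) (θ : ℝ) : ℝ :=
  Real.cos θ * (∫ s in α..θ, Real.cos s * g s) + Real.sin θ * ∫ s in α..θ, Real.sin s * g s

/-- The primitive of `oscillator α g` that vanishes at `α`. -/
noncomputable def oscillatorPrimitive (α : ℝ) (g : ℝ → ℝ) (θ : ℝ) : ℝ :=
  Real.sin θ * (∫ s in α..θ, Real.cos s * g s) - Real.cos θ * ∫ s in α..θ, Real.sin s * g s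

theorem hasDerivWithinAt_integral {f : ℝ → ℝ} (hf : ∀ a b, IntervalIntegrable f volume a b)
    (hr : ∀ θ, Tendsto f (𝓝[>] θ) (𝓝 (f θ))) (α θ : ℝ) :
    HasDerivWithinAt (fun x => ∫ s in α..x, f s) (f θ) (Ioi θ) θ := by
  refine hasDerivWithinAt_Ioi_iff_Ici.2 ?_
  have hm : StronglyMeasurableAtFilter f (𝓝[>] θ) := by
    refine ⟨Ioc (θ - 1) (θ + 1), nhdsWithin_le_nhds (Ioc_mem_nhds (by linarith) (by linarith)), ?_⟩
    have := hf (θ - 1) (θ + 1)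
    rw [intervalIntegrable_iff, uIoc_of_le (by linarith)] at this
    exact this.aestronglyMeasurable
  exact intervalIntegral.integral_hasDerivWithinAt_of_tendsto_ae_right (hf _ _) hm
    ((hr θ).mono_left inf_le_left)

theorem curvaturePrimitive_oscillator {g : ℝ → ℝ}
    (hg : ∀ a b, IntervalIntegrable g volume a b)
    (hr : ∀ θ, Tendsto g (𝓝[>] θ) (𝓝 (g θ))) (α : ℝ) :
    CurvaturePrimitive (oscillator α g) (oscillatorPrimitive α g) g := by
  have hc : ∀ a b, IntervalIntegrable (fun s => Real.cos s * g s) volume a b := fun a b =>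
    (hg a b).continuousOn_mul Real.continuous_cos.continuousOn
  have hs : ∀ a b, IntervalIntegrable (fun s => Real.sin s * g s) volume a b := fun a b =>
    (hg a b).continuousOn_mul Real.continuous_sin.continuousOn
  have hPc : Continuous fun θ => ∫ s in α..θ, Real.cos s * g s :=
    intervalIntegral.continuous_primitive hc α
  have hQc : Continuous fun θ => ∫ s in α..θ, Real.sin s * g s :=
    intervalIntegral.continuous_primitive hs α
  have hP : ∀ θ, HasDerivWithinAt (fun x => ∫ s in α..x, Real.cos s * g s)
      (Real.cos θ * g θ) (Ioi θ) θ := fun θ => hasDerivWithinAt_integral hc (fun θ =>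
        (Real.continuous_cos.continuousAt.tendsto.mono_left nhdsWithin_le_nhds).mul (hr θ)) α θ
  have hQ : ∀ θ, HasDerivWithinAt (fun x => ∫ s in α..x, Real.sin s * g s)
      (Real.sin θ * g θ) (Ioi θ) θ := fun θ => hasDerivWithinAt_integral hs (fun θ =>
        (Real.continuous_sin.continuousAt.tendsto.mono_left nhdsWithin_le_nhds).mul (hr θ)) α θ
  have hvc : Continuous (oscillator α g) :=
    (Real.continuous_cos.mul hPc).add (Real.continuous_sin.mul hQc)
  have hVc : Continuous (oscillatorPrimitive α g) :=
    (Real.continuous_sin.mul hPc).sub (Real.continuous_cos.mul hQc)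
  have hv' : ∀ θ, HasDerivWithinAt (oscillator α g) (g θ - oscillatorPrimitive α g θ) (Ioi θ) θ :=
    fun θ => by
      refine (((Real.hasDerivAt_cos θ).hasDerivWithinAt.mul (hP θ)).add
        ((Real.hasDerivAt_sin θ).hasDerivWithinAt.mul (hQ θ))).congr_deriv ?_
      have := Real.sin_sq_add_cos_sq θ
      unfold oscillatorPrimitive
      linear_combination g θ * this
  have hV' : ∀ θ, HasDerivWithinAt (oscillatorPrimitive α g) (oscillator α g θ) (Ioi θ) θ :=
    fun θ => by
      refine (((Real.hasDerivAt_sin θ).hasDerivWithinAt.mul (hP θ)).sub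
        ((Real.hasDerivAt_cos θ).hasDerivWithinAt.mul (hQ θ))).congr_deriv ?_
      unfold oscillator
      ring
  have hVeq : oscillatorPrimitive α g =
      fun θ => oscillatorPrimitive α g 0 + ∫ s in (0 : ℝ)..θ, oscillator α g s := by
    funext θ
    rw [intervalIntegral.integral_eq_sub_of_hasDeriv_right hVc.continuousOn (fun s _ => hV' s)
      (hvc.intervalIntegrable _ _)]
    ring
  refine ⟨hvc, fun s => ?_, hg, fun x y => ?_⟩
  · rw [hVeq]
    exact (hvc.integral_hasStrictDerivAt 0 s).hasDerivAt.const_add _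
  · exact (intervalIntegral.integral_eq_sub_of_hasDeriv_right hvc.continuousOn (fun s _ => hv' s)
      ((hg x y).sub (hVc.intervalIntegrable _ _))).symm

theorem oscillator_sum {ι : Type*} [Fintype ι] {g : ι → ℝ → ℝ}
    (hg : ∀ i a b, IntervalIntegrable (g i) volume a b) (l : ι → ℝ) (α θ : ℝ) :
    oscillator α (fun s => ∑ i, l i * g i s) θ = ∑ i, l i * oscillator α (g i) θ := by
  have key : ∀ f : ℝ → ℝ, Continuous f → ∫ s in α..θ, f s * ∑ i, l i * g i s =
      ∑ i, l i * ∫ s in α..θ, f s * g i s := fun f hf => by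
    simp only [Finset.mul_sum]
    rw [intervalIntegral.integral_finsetSum fun i _ =>
      ((hg i α θ).const_mul (l i)).continuousOn_mul hf.continuousOn]
    refine Finset.sum_congr rfl fun i _ => ?_
    rw [← intervalIntegral.integral_const_mul]
    congr 1
    funext s
    ring
  unfold oscillator
  rw [key _ Real.continuous_cos, key _ Real.continuous_sin, Finset.mul_sum, Finset.mul_sum,
    ← Finset.sum_add_distrib]
  refine Finset.sum_congr rfl fun i _ => ?_
  ring

theorem oscillator_eq_zero_left {α : ℝ} {g : ℝ → ℝ} (h : ∀ s ≤ α, g s = 0) {θ : ℝ} (hθ : θ ≤ α) :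
    oscillator α g θ = 0 := by
  have key : ∀ f : ℝ → ℝ, ∫ s in α..θ, f s * g s = 0 := fun f => by
    rw [intervalIntegral.integral_congr (g := fun _ => (0 : ℝ))]
    · simp
    · intro s hs
      rw [uIcc_of_ge hθ] at hs
      simp [h s hs.2]
  simp [oscillator, key]

/-- Past `β`, where `g` is constant, the oscillator vanishes as soon as its two moments match. -/
theorem oscillator_eq_zero_right {α β : ℝ} {g : ℝ → ℝ}
    (hg : ∀ a b, IntervalIntegrable g volume a b) (h : ∀ s, β ≤ s → g s = g β)
    (h1 : ∫ s in α..β, Real.cos s * g s = g β * Real.sin β)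
    (h2 : ∫ s in α..β, Real.sin s * g s = -(g β * Real.cos β)) {θ : ℝ} (hθ : β ≤ θ) :
    oscillator α g θ = 0 ∧ oscillatorPrimitive α g θ = g β := by
  have key : ∀ f : ℝ → ℝ, Continuous f → ∫ s in α..θ, f s * g s =
      (∫ s in α..β, f s * g s) + (∫ s in β..θ, f s) * g β := fun f hf => by
    rw [← intervalIntegral.integral_add_adjacent_intervals
      ((hg α β).continuousOn_mul hf.continuousOn) ((hg β θ).continuousOn_mul hf.continuousOn),
      ← intervalIntegral.integral_mul_const]
    congr 1
    refine intervalIntegral.integral_congr fun s hs => ?_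
    rw [uIcc_of_le hθ] at hs
    simp only [h s hs.1]
  have := Real.sin_sq_add_cos_sq θ
  unfold oscillator oscillatorPrimitive
  rw [key _ Real.continuous_cos, key _ Real.continuous_sin, h1, h2, integral_cos, integral_sin]
  constructor
  · ring
  · linear_combination g β * this

/-- The increments of `clampSub a b` are those of the identity, restricted to `[a, b]`. -/
noncomputable def clampSub (a b s : ℝ) : ℝ := max a (min s b) - a

theorem continuous_clampSub (a b : ℝ) : Continuous (clampSub a b) := by
  unfold clampSub
  fun_prop

theorem clampSub_mono (a b : ℝ) : Monotone (clampSub a b) := fun _ _ hst =>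
  sub_le_sub_right (max_le_max le_rfl (min_le_min hst le_rfl)) _

theorem clampSub_sub_le {a b s t : ℝ} (hst : s ≤ t) : clampSub a b t - clampSub a b s ≤ t - s := by
  unfold clampSub
  rcases max_cases a (min t b) with h | h <;> rcases max_cases a (min s b) with h' | h' <;>
    rcases min_cases t b with h1 | h1 <;> rcases min_cases s b with h2 | h2 <;> linarith

theorem clampSub_of_le {a b s : ℝ} (h : s ≤ a) : clampSub a b s = 0 := by
  unfold clampSub
  rw [max_eq_left ((min_le_left _ _).trans h), sub_self]

theorem clampSub_of_ge {a b s : ℝ} (hab : a ≤ b) (h : b ≤ s) : clampSub a b s = b - a := by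
  unfold clampSub
  rw [min_eq_right h, max_eq_right hab]

/-- If the curvature primitive `H` takes five increasing values on a short interval `[q 0, q 4]`,
the interval carries a nonzero function `v`, orthogonal to `ρ`, such that `u + t v` satisfies the
convexity constraint for all small `t` of either sign. The curvature of `v` is that of `u` on the
four subintervals, multiplied by constants; the constants solve the three linear equations saying
that `v` can be extended by zero past `q 4` and that it is orthogonal to `ρ`. -/
theorem CurvaturePrimitive.exists_perturbation {u U ρ : ℝ → ℝ} {H : StieltjesFunction ℝ}
    (hu : W1inf u) (h : CurvaturePrimitive u U H) (hρ : Continuous ρ) {q : Fin 5 → ℝ}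
    (hq : StrictMono (H ∘ q)) (hlen : q 4 < q 0 + 2 * Real.pi) :
    ∃ v : ℝ → ℝ, (∃ K : ℝ≥0, LipschitzWith K v) ∧ (∃ θ, v θ ≠ 0) ∧
      (∀ θ, θ ∉ Ioo (q 0) (q 4) → v θ = 0) ∧ ∫ θ in (q 0)..(q 4), ρ θ * v θ = 0 ∧
      ∃ t₀ > 0, ∀ t, |t| ≤ t₀ → ConvexityConstraint (fun θ => u θ + t * periodize (q 0) v θ) := by
  set α := q 0 with hα
  set β := q 4 with hβ
  set a : Fin 4 → ℝ := fun i => H (q i.castSucc) with ha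
  set b : Fin 4 → ℝ := fun i => H (q i.succ) with hb
  have hab : ∀ i, a i < b i := fun i => hq i.castSucc_lt_succ
  have hαa : ∀ i, H α ≤ a i := fun i => hq.monotone (Fin.zero_le _)
  have hbβ : ∀ i, b i ≤ H β := fun i => hq.monotone (Fin.le_last _)
  have hαβ : α < β := by
    by_contra hcon
    exact absurd (H.mono (not_lt.1 hcon)) (not_le.2 (hq (show (0 : Fin 5) < 4 by decide)))
  set g₁ : Fin 4 → ℝ → ℝ := fun i s => clampSub (a i) (b i) (H s) with hg₁
  have hg₁i : ∀ i x y, IntervalIntegrable (g₁ i) volume x y := fun i x y =>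
    (((clampSub_mono (a i) (b i)).comp H.mono).monotoneOn _).intervalIntegrable
  -- three linear equations in four unknowns
  set c₁ : Fin 4 → ℝ := fun i =>
    (∫ s in α..β, Real.cos s * g₁ i s) - g₁ i β * Real.sin β with hc₁
  set c₂ : Fin 4 → ℝ := fun i =>
    (∫ s in α..β, Real.sin s * g₁ i s) + g₁ i β * Real.cos β with hc₂
  set c₃ : Fin 4 → ℝ := fun i => ∫ s in α..β, ρ s * oscillator α (g₁ i) s with hc₃
  obtain ⟨l, hl, hl0⟩ := (Submodule.ne_bot_iff _).1
    (LinearMap.ker_ne_bot_of_finrank_lt (f := Matrix.mulVecLin (Matrix.of ![c₁, c₂, c₃]))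
      (by simp))
  have e₁ : ∑ i, c₁ i * l i = 0 := congrFun (LinearMap.mem_ker.1 hl) 0
  have e₂ : ∑ i, c₂ i * l i = 0 := congrFun (LinearMap.mem_ker.1 hl) 1
  have e₃ : ∑ i, c₃ i * l i = 0 := congrFun (LinearMap.mem_ker.1 hl) 2
  set g : ℝ → ℝ := fun s => ∑ i, l i * g₁ i s with hg
  have hgi : ∀ x y, IntervalIntegrable g volume x y := fun x y =>
    IntervalIntegrable.sum Finset.univ fun i _ => (hg₁i i x y).const_mul (l i)
  have hψc : Continuous fun r => ∑ i, l i * clampSub (a i) (b i) r :=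
    continuous_finsetSum _ fun i _ => continuous_const.mul (continuous_clampSub _ _)
  have hgr : ∀ θ, Tendsto g (𝓝[>] θ) (𝓝 (g θ)) := fun θ =>
    (hψc.tendsto (H θ)).comp (stieltjes_tendsto_right H θ)
  have hosc := curvaturePrimitive_oscillator hgi hgr α
  set v := oscillator α g with hv
  set V := oscillatorPrimitive α g with hV
  have hgl : ∀ s ≤ α, g s = 0 := fun s hs => Finset.sum_eq_zero fun i _ => by
    simp only [hg₁]
    rw [clampSub_of_le ((H.mono hs).trans (hαa i)), mul_zero]
  have hgright : ∀ s, β ≤ s → g s = g β := fun s hs => Finset.sum_congr rfl fun i _ => by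
    simp only [hg₁]
    rw [clampSub_of_ge (hab i).le ((hbβ i).trans (H.mono hs)),
      clampSub_of_ge (hab i).le (hbβ i)]
  have hsumint : ∀ f : ℝ → ℝ, Continuous f → ∫ s in α..β, f s * g s =
      ∑ i, l i * ∫ s in α..β, f s * g₁ i s := fun f hf => by
    simp only [hg, Finset.mul_sum]
    rw [intervalIntegral.integral_finsetSum fun i _ =>
      ((hg₁i i α β).const_mul (l i)).continuousOn_mul hf.continuousOn]
    refine Finset.sum_congr rfl fun i _ => ?_
    rw [← intervalIntegral.integral_const_mul]
    congr 1
    funext s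
    ring
  have hm1 : ∫ s in α..β, Real.cos s * g s = g β * Real.sin β := by
    have := e₁
    simp only [hc₁, sub_mul, Finset.sum_sub_distrib] at this
    rw [hsumint _ Real.continuous_cos, hg, Finset.sum_mul]
    rw [sub_eq_zero] at this
    convert this using 1
    · exact Finset.sum_congr rfl fun i _ => by ring
    · exact Finset.sum_congr rfl fun i _ => by ring
  have hm2 : ∫ s in α..β, Real.sin s * g s = -(g β * Real.cos β) := by
    have := e₂
    simp only [hc₂, add_mul, Finset.sum_add_distrib] at this
    rw [hsumint _ Real.continuous_sin, hg, Finset.sum_mul]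
    rw [add_eq_zero_iff_eq_neg] at this
    convert this using 1
    · exact Finset.sum_congr rfl fun i _ => by ring
    · congr 1
      exact Finset.sum_congr rfl fun i _ => by ring
  have hm3 : ∫ s in α..β, ρ s * v s = 0 := by
    have hoc : ∀ i, Continuous (oscillator α (g₁ i)) := fun i =>
      (curvaturePrimitive_oscillator (hg₁i i) (fun θ =>
        ((continuous_clampSub (a i) (b i)).tendsto (H θ)).comp (stieltjes_tendsto_right H θ))
        α).continuous
    have hci : ∀ i, Continuous fun s => ρ s * oscillator α (g₁ i) s := fun i => hρ.mul (hoc i)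
    have : ∀ s, ρ s * v s = ∑ i, l i * (ρ s * oscillator α (g₁ i) s) := fun s => by
      rw [hv, hg, oscillator_sum hg₁i, Finset.mul_sum]
      exact Finset.sum_congr rfl fun i _ => by ring
    simp only [this]
    rw [intervalIntegral.integral_finsetSum fun i _ =>
      ((hci i).const_mul (l i)).intervalIntegrable _ _]
    simp only [intervalIntegral.integral_const_mul]
    rw [← e₃]
    exact Finset.sum_congr rfl fun i _ => mul_comm _ _
  have hvl : ∀ θ ≤ α, v θ = 0 := fun θ hθ => oscillator_eq_zero_left hgl hθ
  have hvr : ∀ θ, β ≤ θ → v θ = 0 ∧ V θ = g β := fun θ hθ =>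
    oscillator_eq_zero_right hgi hgright hm1 hm2 hθ
  have hv0 : ∀ θ, θ ∉ Ioo α β → v θ = 0 := fun θ hθ => by
    rcases le_or_gt θ α with h1 | h1
    · exact hvl θ h1
    · exact (hvr θ (not_lt.1 fun h2 => hθ ⟨h1, h2⟩)).1
  have hVα : V α = 0 := by simp [hV, oscillatorPrimitive]
  have hVl : ∀ θ ≤ α, V θ = 0 := fun θ hθ => by
    have := hosc.integral_eq θ α
    rw [intervalIntegral.integral_congr (g := fun _ => (0 : ℝ))] at this
    · simp only [intervalIntegral.integral_zero, hVα] at this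
      linarith
    · intro s hs
      rw [uIcc_of_le hθ] at hs
      exact hvl s hs.2
  -- the derivative `g - V` of `v` is bounded and supported in `[α, β]`
  obtain ⟨K, hK⟩ : ∃ K : ℝ, ∀ s, ‖g s - V s‖ ≤ K := by
    obtain ⟨C, hC⟩ := isCompact_Icc.exists_bound_of_continuousOn (s := Icc (H α) (H β))
      hψc.continuousOn
    obtain ⟨C', hC'⟩ := isCompact_Icc.exists_bound_of_continuousOn (s := Icc α β)
      hosc.continuous_primitive.continuousOn
    have hC0 : 0 ≤ C := (norm_nonneg _).trans (hC (H α) ⟨le_rfl, H.mono hαβ.le⟩)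
    have hC0' : 0 ≤ C' := (norm_nonneg _).trans (hC' α ⟨le_rfl, hαβ.le⟩)
    refine ⟨C + C', fun s => ?_⟩
    rcases le_or_gt s α with h1 | h1
    · rw [hgl s h1, hVl s h1, sub_zero, norm_zero]
      positivity
    rcases le_or_gt β s with h2 | h2
    · rw [hgright s h2, (hvr s h2).2, sub_self, norm_zero]
      positivity
    · exact (norm_sub_le _ _).trans (add_le_add (hC (H s) ⟨H.mono h1.le, H.mono h2.le⟩)
        (hC' s ⟨h1.le, h2.le⟩))
  have hvL : LipschitzWith K.toNNReal v := by
    refine LipschitzWith.of_dist_le_mul fun x y => ?_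
    rw [Real.dist_eq, Real.dist_eq, Real.coe_toNNReal K ((norm_nonneg _).trans (hK 0)),
      hosc.sub_eq y x]
    exact intervalIntegral.norm_integral_le_of_norm_le_const fun s _ => hK s
  refine ⟨v, ⟨_, hvL⟩, ?_, hv0, hm3, 1 / (1 + ∑ i, |l i|), by positivity, fun t ht => ?_⟩
  · by_contra hcon
    push Not at hcon
    have hV0 : ∀ θ, V θ = 0 := fun θ => by
      have := hosc.integral_eq α θ
      simp only [hcon, intervalIntegral.integral_zero, hVα] at this
      linarith
    have hg0 : ∀ θ, g θ = 0 := fun θ => by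
      have h1 := hosc.hasDerivWithinAt_right (hgr θ)
      have h2 : HasDerivWithinAt v 0 (Ioi θ) θ := by
        rw [show v = fun _ => 0 from funext hcon]
        exact hasDerivWithinAt_const _ _ _
      have := (uniqueDiffWithinAt_Ioi θ).eq_deriv _ h1 h2
      rw [hV0] at this
      linarith
    refine hl0 (funext fun i => ?_)
    have hdiff : g (q i.succ) - g (q i.castSucc) = l i * (b i - a i) := by
      simp only [hg]
      rw [← Finset.sum_sub_distrib, Finset.sum_eq_single i]
      · simp only [hg₁]
        rw [clampSub_of_ge (hab i).le le_rfl, clampSub_of_le le_rfl]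
        ring
      · intro j _ hji
        simp only [hg₁]
        rcases lt_or_gt_of_ne hji with hlt | hlt
        · have e1 : b j ≤ H (q i.castSucc) := hq.monotone (Fin.succ_le_castSucc_iff.2 hlt)
          rw [clampSub_of_ge (hab j).le e1, clampSub_of_ge (hab j).le (e1.trans (hab i).le),
            sub_self]
        · have e1 : H (q i.succ) ≤ a j := hq.monotone (Fin.succ_le_castSucc_iff.2 hlt)
          rw [clampSub_of_le e1, clampSub_of_le ((hab i).le.trans e1), sub_self]
      · simp
    rw [hg0, hg0, sub_self] at hdiff
    exact (mul_eq_zero.1 hdiff.symm).resolve_right (sub_pos.2 (hab i)).ne'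
  · set ε₀ := (2 * Real.pi - (β - α)) / 2 with hε₀
    have hε₀pos : 0 < ε₀ := by rw [hε₀]; linarith
    have hper : ∀ θ ∈ Ioo (β - 2 * Real.pi) (α + 2 * Real.pi), periodize α v θ = v θ :=
      fun θ hθ => periodize_eq hαβ.le (fun s hs => hv0 s fun hm => hs ⟨hm.1.le, hm.2.le⟩) hθ
    have hperW : W1inf (periodize α v) :=
      periodize_W1inf hvL (hvl α le_rfl) (hvr _ (by linarith)).1
    refine convexityConstraint_of_increments (k := fun θ => (H θ - U θ) + t * (g θ - V θ))
      (c := α - ε₀) (ε₀ := ε₀) (hu.add (hperW.const_mul t)) hε₀pos ?_ ?_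
    · filter_upwards [compl_mem_ae_iff.2 (H.mono.countable_not_continuousAt.measure_zero volume)]
        with θ hθ hmem
      have hθ : ContinuousAt H θ := by simpa using hθ
      have hgc : ContinuousAt g θ := ContinuousAt.comp (f := H) hψc.continuousAt hθ
      have hev : periodize α v =ᶠ[𝓝 θ] v := by
        filter_upwards [Ioo_mem_nhds (a := β - 2 * Real.pi) (b := α + 2 * Real.pi)
          (by linarith [hmem.1]) (by linarith [hmem.2])] with s hs using hper s hs
      exact ((h.hasDerivAt_of_continuousAt hθ).add
        (((hosc.hasDerivAt_of_continuousAt hgc).congr_of_eventuallyEq hev).const_mul t)).deriv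
    · intro θ hθ ε hε
      have hint : ∫ s in (θ - ε)..θ, (u s + t * periodize α v s) =
          (U θ - U (θ - ε)) + t * (V θ - V (θ - ε)) := by
        rw [intervalIntegral.integral_add (h.continuous.intervalIntegrable _ _)
          ((hperW.continuous.const_mul t).intervalIntegrable _ _), h.integral_eq,
          intervalIntegral.integral_const_mul, ← hosc.integral_eq]
        congr 2
        refine intervalIntegral.integral_congr fun s hs => ?_
        rw [uIcc_of_le (by linarith [hε.1])] at hs
        exact hper s ⟨by linarith [hs.1, hθ.1, hε.2], by linarith [hs.2, hθ.2]⟩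
      rw [hint]
      have hHm : 0 ≤ H θ - H (θ - ε) := sub_nonneg.2 (H.mono (by linarith [hε.1]))
      have hgd : |g θ - g (θ - ε)| ≤ (∑ i, |l i|) * (H θ - H (θ - ε)) := by
        simp only [hg]
        rw [← Finset.sum_sub_distrib, Finset.sum_mul]
        refine (Finset.abs_sum_le_sum_abs _ _).trans (Finset.sum_le_sum fun i _ => ?_)
        rw [← mul_sub, abs_mul]
        refine mul_le_mul_of_nonneg_left ?_ (abs_nonneg _)
        rw [abs_of_nonneg (sub_nonneg.2 (clampSub_mono _ _ (sub_nonneg.1 hHm)))]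
        exact clampSub_sub_le (sub_nonneg.1 hHm)
      have hS : 0 ≤ ∑ i, |l i| := Finset.sum_nonneg fun i _ => abs_nonneg _
      have htS : |t| * (∑ i, |l i|) ≤ 1 := by
        rw [le_div_iff₀ (by positivity)] at ht
        nlinarith [abs_nonneg t]
      have : |t * (g θ - g (θ - ε))| ≤ H θ - H (θ - ε) := by
        rw [abs_mul]
        calc |t| * |g θ - g (θ - ε)| ≤ |t| * ((∑ i, |l i|) * (H θ - H (θ - ε))) :=
              mul_le_mul_of_nonneg_left hgd (abs_nonneg _)
          _ = (|t| * ∑ i, |l i|) * (H θ - H (θ - ε)) := by ring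
          _ ≤ 1 * (H θ - H (θ - ε)) := mul_le_mul_of_nonneg_right htS hHm
          _ = _ := one_mul _
      have := (abs_le.1 this).1
      linarith

/-! ### Second differences of the integrand -/

theorem second_difference_le {φ φ' φ'' : ℝ → ℝ} {M : ℝ} (h1 : ∀ t, HasDerivAt φ (φ' t) t)
    (h2 : ∀ t, HasDerivAt φ' (φ'' t) t) (hM : ∀ t ∈ Ioo (-1 : ℝ) 1, φ'' t ≤ M) :
    φ 1 + φ (-1) - 2 * φ 0 ≤ M := by
  have hconc : ConcaveOn ℝ (Icc (-1 : ℝ) 1) (fun t => φ t - M / 2 * t ^ 2) := by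
    refine concaveOn_of_hasDerivWithinAt2_nonpos (f' := fun t => φ' t - M * t)
      (f'' := fun t => φ'' t - M) (convex_Icc _ _) ?_ ?_ ?_ ?_
    · have : Continuous φ := continuous_iff_continuousAt.2 fun t => (h1 t).continuousAt
      exact (this.sub (by fun_prop)).continuousOn
    · intro t _
      refine (((h1 t).sub ((hasDerivAt_pow 2 t).const_mul (M / 2))).congr_deriv ?_).hasDerivWithinAt
      simp
      ring
    · intro t _
      exact (((h2 t).sub ((hasDerivAt_id t).const_mul M)).congr_deriv (by simp)).hasDerivWithinAt
    · intro t ht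
      rw [interior_Icc] at ht
      exact sub_nonpos.2 (hM t ht)
  obtain ⟨-, hc⟩ := hconc
  have := hc (x := -1) (by norm_num) (y := 1) (by norm_num) (a := 1 / 2) (b := 1 / 2)
    (by norm_num) (by norm_num) (by norm_num)
  norm_num at this
  linarith

/-- A `C²` function that is strictly concave in its last variable at a point has second
differences, in the last two variables, bounded by `C y² - K r²` near that point. -/
theorem exists_second_difference_le {F : ℝ × ℝ × ℝ → ℝ} (hF : ContDiff ℝ 2 F) {z₀ : ℝ × ℝ × ℝ}
    (hneg : fderiv ℝ (fderiv ℝ F) z₀ (0, 0, 1) (0, 0, 1) < 0) :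
    ∃ δ > 0, ∃ C ≥ 0, ∃ K > 0, ∀ z, dist z z₀ < δ → ∀ y r : ℝ, |y| < δ → |r| < δ →
      F (z + (0, y, r)) + F (z - (0, y, r)) - 2 * F z ≤ C * y ^ 2 - K * r ^ 2 := by
  have hF1 : ContDiff ℝ 1 (fderiv ℝ F) := hF.fderiv_right (by norm_num)
  have hd1 : Differentiable ℝ F := hF.differentiable (by norm_num)
  have hd2 : Differentiable ℝ (fderiv ℝ F) := hF1.differentiable (by norm_num)
  set B := fderiv ℝ (fderiv ℝ F) with hB
  have hBc : Continuous B := hF1.continuous_fderiv (by norm_num)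
  set e₂ : ℝ × ℝ × ℝ := (0, 1, 0) with he₂
  set e₃ : ℝ × ℝ × ℝ := (0, 0, 1) with he₃
  set K := -(B z₀ e₃ e₃) / 4 with hK
  have hK0 : 0 < K := by rw [hK]; linarith
  have hc : ∀ x x' : ℝ × ℝ × ℝ, Continuous fun z => B z x x' := fun x x' =>
    (hBc.clm_apply continuous_const).clm_apply continuous_const
  have ev1 : ∀ᶠ z in 𝓝 z₀, B z e₃ e₃ < -2 * K := by
    refine (hc e₃ e₃).continuousAt.eventually_lt continuousAt_const ?_
    rw [hK]
    linarith
  set C := |B z₀ e₂ e₂| + |B z₀ e₂ e₃ + B z₀ e₃ e₂| + 1 with hC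
  have ev2 : ∀ᶠ z in 𝓝 z₀, |B z e₂ e₂| < C := by
    refine (hc e₂ e₂).abs.continuousAt.eventually_lt continuousAt_const ?_
    rw [hC]
    linarith [abs_nonneg (B z₀ e₂ e₃ + B z₀ e₃ e₂)]
  have ev3 : ∀ᶠ z in 𝓝 z₀, |B z e₂ e₃ + B z e₃ e₂| < C := by
    have hs : Continuous fun z => |B z e₂ e₃ + B z e₃ e₂| := ((hc e₂ e₃).add (hc e₃ e₂)).abs
    refine hs.continuousAt.eventually_lt continuousAt_const ?_
    rw [hC]
    linarith [abs_nonneg (B z₀ e₂ e₂)]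
  obtain ⟨δ, hδ, hball⟩ := Metric.eventually_nhds_iff.1 (ev1.and (ev2.and ev3))
  have hC0 : 0 < C := by positivity
  refine ⟨δ / 2, by positivity, C + C ^ 2 / K, by positivity, K, hK0, fun z hz y r hy hr => ?_⟩
  set w : ℝ × ℝ × ℝ := (0, y, r) with hw
  have hwe : w = y • e₂ + r • e₃ := by simp [hw, he₂, he₃]
  have hwn : ‖w‖ < δ / 2 := by
    simp only [hw, Prod.norm_def, norm_zero, Real.norm_eq_abs]
    exact max_lt (by positivity) (max_lt hy hr)
  have hline : ∀ t : ℝ, HasDerivAt (fun t : ℝ => z + t • w) w t := fun t => by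
    simpa using ((hasDerivAt_id t).smul_const w).const_add z
  have h1 : ∀ t : ℝ, HasDerivAt (fun t : ℝ => F (z + t • w)) (fderiv ℝ F (z + t • w) w) t :=
    fun t => (hd1 (z + t • w)).hasFDerivAt.comp_hasDerivAt t (hline t)
  have h2 : ∀ t : ℝ, HasDerivAt (fun t : ℝ => fderiv ℝ F (z + t • w) w) (B (z + t • w) w w) t :=
    fun t => by
      have := (hd2 (z + t • w)).hasFDerivAt.comp_hasDerivAt t (hline t)
      simpa using this.clm_apply (hasDerivAt_const t w)
  have key := second_difference_le h1 h2 (M := (C + C ^ 2 / K) * y ^ 2 - K * r ^ 2) ?_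
  · simpa [sub_eq_add_neg] using key
  intro t ht
  have hmem : dist (z + t • w) z₀ < δ := by
    have : dist (z + t • w) z ≤ ‖w‖ := by
      rw [dist_eq_norm, add_sub_cancel_left, norm_smul, Real.norm_eq_abs]
      have : |t| ≤ 1 := (abs_lt.2 ht).le
      nlinarith [norm_nonneg w]
    linarith [dist_triangle (z + t • w) z z₀]
  obtain ⟨hb1, hb2, hb3⟩ := hball hmem
  set A := B (z + t • w) with hA
  have hexp : A w w = y ^ 2 * A e₂ e₂ + y * r * (A e₂ e₃ + A e₃ e₂) + r ^ 2 * A e₃ e₃ := by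
    rw [hwe]
    simp only [map_add, map_smul, add_apply, smul_apply, smul_eq_mul]
    ring
  rw [hexp]
  have i1 : y ^ 2 * A e₂ e₂ ≤ y ^ 2 * C :=
    mul_le_mul_of_nonneg_left (le_of_abs_le hb2.le) (sq_nonneg y)
  have i3 : r ^ 2 * A e₃ e₃ ≤ r ^ 2 * (-2 * K) := mul_le_mul_of_nonneg_left hb1.le (sq_nonneg r)
  have i2 : y * r * (A e₂ e₃ + A e₃ e₂) ≤ C ^ 2 / K * y ^ 2 + K * r ^ 2 := by
    have h5 : |A e₂ e₃ + A e₃ e₂| ≤ 2 * C := by linarith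
    have h6 : y * r * (A e₂ e₃ + A e₃ e₂) ≤ |y| * |r| * (2 * C) := by
      refine (le_abs_self _).trans ?_
      rw [abs_mul, abs_mul]
      exact mul_le_mul_of_nonneg_left h5 (by positivity)
    refine h6.trans ?_
    have h7 : 0 ≤ (C * |y| - K * |r|) ^ 2 / K := by positivity
    have h8 : (C * |y| - K * |r|) ^ 2 / K =
        C ^ 2 / K * |y| ^ 2 + K * |r| ^ 2 - |y| * |r| * (2 * C) := by
      field_simp
      ring
    rw [sq_abs, sq_abs] at h8
    linarith
  linarith

theorem deriv_deriv_snd_snd {F : ℝ × ℝ × ℝ → ℝ} (hF : ContDiff ℝ 2 F) (a b p : ℝ) :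
    deriv (deriv fun q => F (a, b, q)) p =
      fderiv ℝ (fderiv ℝ F) (a, b, p) (0, 0, 1) (0, 0, 1) := by
  have hF1 : ContDiff ℝ 1 (fderiv ℝ F) := hF.fderiv_right (by norm_num)
  have hd1 : Differentiable ℝ F := hF.differentiable (by norm_num)
  have hd2 : Differentiable ℝ (fderiv ℝ F) := hF1.differentiable (by norm_num)
  have hline : ∀ q : ℝ, HasDerivAt (fun q : ℝ => ((a, b, q) : ℝ × ℝ × ℝ)) (0, 0, 1) q := fun q =>
    (hasDerivAt_const q a).prodMk ((hasDerivAt_const q b).prodMk (hasDerivAt_id q))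
  have h1 : deriv (fun q => F (a, b, q)) = fun q => fderiv ℝ F (a, b, q) (0, 0, 1) := by
    funext q
    exact ((hd1 (a, b, q)).hasFDerivAt.comp_hasDerivAt q (hline q)).deriv
  rw [h1]
  have h2 := (hd2 (a, b, p)).hasFDerivAt.comp_hasDerivAt p (hline p)
  have h3 : HasDerivAt (fun q => fderiv ℝ F (a, b, q) (0, 0, 1))
      (fderiv ℝ (fderiv ℝ F) (a, b, p) (0, 0, 1) (0, 0, 1)) p := by
    simpa using h2.clm_apply (hasDerivAt_const p ((0, 0, 1) : ℝ × ℝ × ℝ))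
  exact h3.deriv

theorem Gpp_eq {G : ℝ → ℝ → ℝ → ℝ}
    (hG : ContDiff ℝ 2 (fun x : ℝ × ℝ × ℝ => G x.1 x.2.1 x.2.2)) (θ u p : ℝ) :
    Gpp G θ u p = fderiv ℝ (fderiv ℝ (fun x : ℝ × ℝ × ℝ => G x.1 x.2.1 x.2.2)) (θ, u, p)
      (0, 0, 1) (0, 0, 1) := by
  rw [← deriv_deriv_snd_snd hG]
  unfold Gpp
  rw [iteratedDeriv_succ, iteratedDeriv_one]

/-- Strong concavity along `u` bounds the second differences of the integrand at the points
`(θ, u θ, u' θ)` with `θ` close to `θ₀`: as `θ` tends to `θ₀` from either side, these points tend to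
one of the two points given by the one-sided derivatives at `θ₀`. -/
theorem StronglyConcaveAlong.exists_second_difference_le {G : ℝ → ℝ → ℝ → ℝ}
    (hG : ContDiff ℝ 2 (fun x : ℝ × ℝ × ℝ => G x.1 x.2.1 x.2.2)) {u U : ℝ → ℝ}
    {H : StieltjesFunction ℝ} (h : CurvaturePrimitive u U H) (hconc : StronglyConcaveAlong G u)
    (θ₀ : ℝ) :
    ∃ η > 0, ∃ δ > 0, ∃ C ≥ 0, ∃ K > 0, ∀ᵐ θ, θ ∈ Ioo (θ₀ - η) (θ₀ + η) → ∀ y r : ℝ,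
      |y| < δ → |r| < δ →
      G θ (u θ + y) (deriv u θ + r) + G θ (u θ - y) (deriv u θ - r) - 2 * G θ (u θ) (deriv u θ)
        ≤ C * y ^ 2 - K * r ^ 2 := by
  set F := fun x : ℝ × ℝ × ℝ => G x.1 x.2.1 x.2.2 with hFdef
  have side : ∀ (l : Filter ℝ) (p : ℝ), l ≤ 𝓝 θ₀ → Tendsto H l (𝓝 (p + U θ₀)) →
      Gpp G θ₀ (u θ₀) p < 0 → ∃ δ > 0, ∃ C ≥ 0, ∃ K > 0, ∀ᶠ θ in l, ∀ y r : ℝ,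
      |y| < δ → |r| < δ → G θ (u θ + y) (H θ - U θ + r) + G θ (u θ - y) (H θ - U θ - r) -
        2 * G θ (u θ) (H θ - U θ) ≤ C * y ^ 2 - K * r ^ 2 := by
    intro l p hl hp hneg
    rw [Gpp_eq hG] at hneg
    obtain ⟨δ, hδ, C, hC, K, hK, hb⟩ := ConvexShape.exists_second_difference_le hG hneg
    refine ⟨δ, hδ, C, hC, K, hK, ?_⟩
    have ht : Tendsto (fun θ => ((θ, u θ, H θ - U θ) : ℝ × ℝ × ℝ)) l (𝓝 (θ₀, u θ₀, p)) := by
      refine (tendsto_id.mono_left hl).prodMk_nhds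
        ((h.continuous.continuousAt.tendsto.mono_left hl).prodMk_nhds ?_)
      have := hp.sub (h.continuous_primitive.continuousAt.tendsto.mono_left hl)
      rwa [add_sub_cancel_right] at this
    filter_upwards [ht (Metric.ball_mem_nhds _ hδ)] with θ hθ y r hy hr
    have := hb _ hθ y r hy hr
    simpa [hFdef] using this
  obtain ⟨δ₁, hδ₁, C₁, hC₁, K₁, hK₁, h₁⟩ := side (𝓝[>] θ₀) (H θ₀ - U θ₀) nhdsWithin_le_nhds
    (by rw [sub_add_cancel]; exact stieltjes_tendsto_right H θ₀)
    (hconc _ _ (Or.inl (h.hasDerivWithinAt_Ioi θ₀)))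
  obtain ⟨δ₂, hδ₂, C₂, hC₂, K₂, hK₂, h₂⟩ := side (𝓝[<] θ₀) (leftLim H θ₀ - U θ₀)
    nhdsWithin_le_nhds (by rw [sub_add_cancel]; exact H.mono.tendsto_leftLim θ₀)
    (hconc _ _ (Or.inr (h.hasDerivWithinAt_Iio θ₀)))
  have hcomb : ∀ᶠ θ in 𝓝[≠] θ₀, ∀ y r : ℝ, |y| < min δ₁ δ₂ → |r| < min δ₁ δ₂ →
      G θ (u θ + y) (H θ - U θ + r) + G θ (u θ - y) (H θ - U θ - r) -
        2 * G θ (u θ) (H θ - U θ) ≤ max C₁ C₂ * y ^ 2 - min K₁ K₂ * r ^ 2 := by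
    rw [← Iio_union_Ioi, nhdsWithin_union, eventually_sup]
    constructor
    · filter_upwards [h₂] with θ hθ y r hy hr
      have := hθ y r (hy.trans_le (min_le_right _ _)) (hr.trans_le (min_le_right _ _))
      have e1 := mul_le_mul_of_nonneg_right (le_max_right C₁ C₂) (sq_nonneg y)
      have e2 := mul_le_mul_of_nonneg_right (min_le_right K₁ K₂) (sq_nonneg r)
      linarith
    · filter_upwards [h₁] with θ hθ y r hy hr
      have := hθ y r (hy.trans_le (min_le_left _ _)) (hr.trans_le (min_le_left _ _))
      have e1 := mul_le_mul_of_nonneg_right (le_max_left C₁ C₂) (sq_nonneg y)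
      have e2 := mul_le_mul_of_nonneg_right (min_le_left K₁ K₂) (sq_nonneg r)
      linarith
  rw [eventually_nhdsWithin_iff, Metric.eventually_nhds_iff] at hcomb
  obtain ⟨η, hη, hcomb⟩ := hcomb
  refine ⟨η, hη, min δ₁ δ₂, lt_min hδ₁ hδ₂, max C₁ C₂, le_max_of_le_left hC₁, min K₁ K₂,
    lt_min hK₁ hK₂, ?_⟩
  filter_upwards [h.ae_hasDerivAt, compl_mem_ae_iff.2 (show volume {θ₀} = 0 by simp)]
    with θ h3 h4 hθ
  rw [h3.deriv]
  refine hcomb ?_ h4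
  rw [Real.dist_eq, abs_lt]
  constructor <;> linarith [hθ.1, hθ.2]

/-- Poincaré inequality on a short interval. -/
theorem poincare {v : ℝ → ℝ} {L : ℝ≥0} (hv : LipschitzWith L v) {α β : ℝ} (hαβ : α ≤ β)
    (hβ : v β = 0) :
    ∫ θ in α..β, v θ ^ 2 ≤ 4 * (β - α) ^ 2 * ∫ θ in α..β, deriv v θ ^ 2 := by
  have hvc := hv.continuous
  have hid : LipschitzWith 1 (fun θ : ℝ => θ - α) :=
    LipschitzWith.of_dist_le_mul fun x y => by simp [Real.dist_eq]
  have hac : AbsolutelyContinuousOnInterval ((fun θ => θ - α) * (v * v)) α β :=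
    hid.lipschitzOnWith.absolutelyContinuousOnInterval.mul
      (hv.lipschitzOnWith.absolutelyContinuousOnInterval.mul
        hv.lipschitzOnWith.absolutelyContinuousOnInterval)
  have hi1 : IntervalIntegrable (fun θ => v θ ^ 2) volume α β := (hvc.pow 2).intervalIntegrable _ _
  have hi2 : IntervalIntegrable (fun θ => deriv v θ ^ 2) volume α β := by
    simpa only [sq] using intervalIntegrable_deriv_mul_deriv hv hv α β
  have h0 := hac.integral_deriv_eq_sub
  simp only [Pi.mul_apply, hβ, sub_self, zero_mul, mul_zero] at h0
  have hle : ∫ θ in α..β, (1 / 2 * v θ ^ 2 - 2 * (β - α) ^ 2 * deriv v θ ^ 2) ≤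
      ∫ θ in α..β, deriv ((fun θ => θ - α) * (v * v)) θ := by
    refine intervalIntegral.integral_mono_ae_restrict hαβ
      ((hi1.const_mul _).sub (hi2.const_mul _)) hac.intervalIntegrable_deriv ?_
    refine (ae_restrict_iff' measurableSet_Icc).2 ?_
    filter_upwards [hv.ae_differentiableAt] with θ hd hθ
    have := (((hasDerivAt_id θ).sub_const α).mul (hd.hasDerivAt.mul hd.hasDerivAt)).deriv
    have e : ((fun θ => θ - α) * (v * v)) = ((fun x => id x - α) * (v * v)) := rfl
    rw [e, this]
    simp only [id, Pi.mul_apply]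
    have h1 : 0 ≤ θ - α := by linarith [hθ.1]
    have h2 : (θ - α) ^ 2 ≤ (β - α) ^ 2 := by
      refine pow_le_pow_left₀ h1 ?_ 2
      linarith [hθ.2]
    have h3 := mul_le_mul_of_nonneg_right h2 (sq_nonneg (deriv v θ))
    nlinarith [sq_nonneg (v θ + 2 * (θ - α) * deriv v θ)]
  rw [h0, intervalIntegral.integral_sub (hi1.const_mul _) (hi2.const_mul _),
    intervalIntegral.integral_const_mul, intervalIntegral.integral_const_mul] at hle
  linarith

/-! ### Negativity of the second variation -/

theorem intervalIntegrable_integrand {G : ℝ → ℝ → ℝ → ℝ}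
    (hG : Continuous (fun x : ℝ × ℝ × ℝ => G x.1 x.2.1 x.2.2)) {u : ℝ → ℝ} (hu : W1inf u)
    (a b : ℝ) : IntervalIntegrable (fun θ => G θ (u θ) (deriv u θ)) volume a b := by
  obtain ⟨L, hL⟩ := hu.1
  obtain ⟨R, hR⟩ := isCompact_uIcc.exists_bound_of_continuousOn (s := uIcc a b)
    hu.continuous.continuousOn
  obtain ⟨C, hC⟩ := (isCompact_uIcc (a := a) (b := b)).prod
    ((isCompact_Icc (a := -R) (b := R)).prod (isCompact_Icc (a := -(L : ℝ)) (b := L)))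
    |>.exists_bound_of_continuousOn hG.continuousOn
  have hm : Measurable fun θ => G θ (u θ) (deriv u θ) :=
    hG.measurable.comp (measurable_id.prodMk (hu.continuous.measurable.prodMk (measurable_deriv u)))
  rw [intervalIntegrable_iff]
  refine Measure.integrableOn_of_bounded (M := C) (by simp [uIoc]) hm.aestronglyMeasurable ?_
  refine (ae_restrict_mem measurableSet_uIoc).mono fun θ hθ => ?_
  have hθ' := uIoc_subset_uIcc hθ
  exact hC (θ, u θ, deriv u θ) ⟨hθ', abs_le.1 (hR θ hθ'), abs_le.1 (abs_deriv_le_of_lipschitz hL θ)⟩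

theorem functional_eq_integral {G : ℝ → ℝ → ℝ → ℝ}
    (hper : ∀ θ u p : ℝ, G (θ + 2 * Real.pi) u p = G θ u p) {u : ℝ → ℝ} (hu : W1inf u) (c : ℝ) :
    functional G u = ∫ θ in c..c + 2 * Real.pi, G θ (u θ) (deriv u θ) := by
  have hp : Function.Periodic (fun θ => G θ (u θ) (deriv u θ)) (2 * Real.pi) := fun θ => by
    simp only [hu.periodic θ, periodic_deriv hu.periodic θ, hper]
  unfold functional
  rw [← hp.intervalIntegral_add_eq 0 c, zero_add]

/-- Where the integrand is strongly concave in `u'`, the second variation of the functional is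
negative in the direction of every nonzero function supported in a short interval; by the Poincaré
inequality it stays negative after adding a multiple of the squared `L²` norm. -/
theorem StronglyConcaveAlong.second_variation_neg {G : ℝ → ℝ → ℝ → ℝ}
    (hG : ContDiff ℝ 2 (fun x : ℝ × ℝ × ℝ => G x.1 x.2.1 x.2.2))
    (hper : ∀ θ u p : ℝ, G (θ + 2 * Real.pi) u p = G θ u p)
    {u U : ℝ → ℝ} {H : StieltjesFunction ℝ} (hu : W1inf u) (h : CurvaturePrimitive u U H)
    (hconc : StronglyConcaveAlong G u) (θ₀ D : ℝ) :
    ∃ η > 0, η < Real.pi ∧ ∀ α β : ℝ, θ₀ - η < α → α < β → β < θ₀ + η →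
      ∀ (v : ℝ → ℝ) (L : ℝ≥0), LipschitzWith L v → (∃ θ, v θ ≠ 0) →
      (∀ θ, θ ∉ Ioo α β → v θ = 0) → ∃ t₁ > 0, ∀ t, 0 < |t| → |t| ≤ t₁ →
        functional G (fun θ => u θ + t * periodize α v θ) +
          functional G (fun θ => u θ + -t * periodize α v θ) - 2 * functional G u +
          D * (t ^ 2 * ∫ θ in α..β, v θ ^ 2) < 0 := by
  obtain ⟨η₀, hη₀, δ, hδ, C, hC, K, hK, hsd⟩ := hconc.exists_second_difference_le hG h θ₀
  have hpi := Real.pi_pos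
  -- `η` is so small that `(C + |D|) * 4 * (2 η) ^ 2 < K`
  obtain ⟨η, hη, hηη₀, hηπ, hηK⟩ : ∃ η > 0, η ≤ η₀ ∧ η < Real.pi ∧
      (C + |D|) * (4 * (2 * η) ^ 2) < K := by
    have hc : Continuous fun η : ℝ => (C + |D|) * (4 * (2 * η) ^ 2) := by fun_prop
    have ev1 : ∀ᶠ η in 𝓝[>] (0 : ℝ), (C + |D|) * (4 * (2 * η) ^ 2) < K :=
      nhdsWithin_le_nhds (hc.continuousAt.eventually_lt continuousAt_const (by simpa using hK))
    obtain ⟨η, h1, h2⟩ := (ev1.and (Ioo_mem_nhdsGT (lt_min hη₀ hpi))).exists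
    exact ⟨η, h2.1, (h2.2.trans_le (min_le_left _ _)).le, h2.2.trans_le (min_le_right _ _), h1⟩
  refine ⟨η, hη, hηπ, fun α β hα hαβ hβ v L hv hne hv0 => ?_⟩
  have hvα : v α = 0 := hv0 α fun hm => lt_irrefl _ hm.1
  have hvβ : v β = 0 := hv0 β fun hm => lt_irrefl _ hm.2
  have hvc := hv.continuous
  have hvB : ∀ θ, |v θ| ≤ L * (β - α) := abs_le_of_lipschitz hv hαβ.le hv0
  set w := periodize α v with hw
  have hwW : W1inf w := periodize_W1inf hv hvα (hv0 _ fun hm => by linarith [hm.2])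
  have hwv : ∀ θ ∈ Ioo (β - 2 * Real.pi) (α + 2 * Real.pi), w θ = v θ := fun θ hθ =>
    periodize_eq hαβ.le (fun s hs => hv0 s fun hm => hs ⟨hm.1.le, hm.2.le⟩) hθ
  have hwd : ∀ θ ∈ Ioo (β - 2 * Real.pi) (α + 2 * Real.pi), deriv w θ = deriv v θ := fun θ hθ =>
    EventuallyEq.deriv_eq (by
      filter_upwards [Ioo_mem_nhds hθ.1 hθ.2] with s hs using hwv s hs)
  have hi1 : IntervalIntegrable (fun θ => v θ ^ 2) volume α β := (hvc.pow 2).intervalIntegrable _ _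
  have hi2 : IntervalIntegrable (fun θ => deriv v θ ^ 2) volume α β := by
    simpa only [sq] using intervalIntegrable_deriv_mul_deriv hv hv α β
  have hpos : 0 < ∫ θ in α..β, v θ ^ 2 := by
    obtain ⟨θ₁, hθ₁⟩ := hne
    have hm : θ₁ ∈ Ioo α β := by
      by_contra hm
      exact hθ₁ (hv0 _ hm)
    exact intervalIntegral.integral_pos hαβ (hvc.pow 2).continuousOn (fun _ _ => sq_nonneg _)
      ⟨θ₁, ⟨hm.1.le, hm.2.le⟩, by positivity⟩
  have hpoin := poincare hv hαβ.le hvβ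
  have hquad : (C + D) * (∫ θ in α..β, v θ ^ 2) - K * ∫ θ in α..β, deriv v θ ^ 2 < 0 := by
    set I := ∫ θ in α..β, v θ ^ 2
    set J := ∫ θ in α..β, deriv v θ ^ 2 with hJdef
    have hJ : 0 < J := by
      by_contra hcon
      have : 4 * (β - α) ^ 2 * J ≤ 0 := mul_nonpos_of_nonneg_of_nonpos (by positivity)
        (not_lt.1 hcon)
      linarith
    have h1 : I ≤ 4 * (2 * η) ^ 2 * J := by
      refine hpoin.trans (mul_le_mul_of_nonneg_right ?_ hJ.le)
      have : (β - α) ^ 2 ≤ (2 * η) ^ 2 :=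
        pow_le_pow_left₀ (by linarith) (by linarith) 2
      linarith
    have h2 : (C + D) * I ≤ (C + |D|) * I :=
      mul_le_mul_of_nonneg_right (by linarith [le_abs_self D]) hpos.le
    have h3 : (C + |D|) * I ≤ (C + |D|) * (4 * (2 * η) ^ 2 * J) :=
      mul_le_mul_of_nonneg_left h1 (by positivity)
    have h4 : (C + |D|) * (4 * (2 * η) ^ 2) * J < K * J := mul_lt_mul_of_pos_right hηK hJ
    linarith
  set B : ℝ := L * (β - α) + L + 1 with hB
  have hB0 : 0 < B := by
    have : 0 ≤ (L : ℝ) * (β - α) := mul_nonneg L.2 (by linarith)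
    have : (0 : ℝ) ≤ L := L.2
    linarith
  refine ⟨δ / (2 * B), by positivity, fun t ht0 ht => ?_⟩
  have htδ : |t| * B < δ := by
    rw [le_div_iff₀ (by positivity)] at ht
    linarith
  have hWp : W1inf fun θ => u θ + t * w θ := hu.add (hwW.const_mul t)
  have hWm : W1inf fun θ => u θ + -t * w θ := hu.add (hwW.const_mul (-t))
  have hGc := hG.continuous
  have hgp := fun a b => intervalIntegrable_integrand hGc hWp a b
  have hgm := fun a b => intervalIntegrable_integrand hGc hWm a b
  have hg0 := fun a b => intervalIntegrable_integrand hGc hu a b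
  rw [functional_eq_integral hper hWp α, functional_eq_integral hper hWm α,
    functional_eq_integral hper hu α, ← intervalIntegral.integral_add (hgp _ _) (hgm _ _),
    ← intervalIntegral.integral_const_mul,
    ← intervalIntegral.integral_sub ((hgp _ _).add (hgm _ _)) ((hg0 _ _).const_mul 2)]
  have hfi : ∀ a b, IntervalIntegrable (fun θ =>
      G θ (u θ + t * w θ) (deriv (fun θ => u θ + t * w θ) θ) +
      G θ (u θ + -t * w θ) (deriv (fun θ => u θ + -t * w θ) θ) - 2 * G θ (u θ) (deriv u θ))
      volume a b := fun a b => ((hgp a b).add (hgm a b)).sub ((hg0 a b).const_mul 2)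
  rw [← intervalIntegral.integral_add_adjacent_intervals (hfi α β) (hfi β _)]
  obtain ⟨Lu, hLu⟩ := hu.1
  obtain ⟨Lw, hLw⟩ := hwW.1
  have hzero : ∫ θ in β..α + 2 * Real.pi,
      (G θ (u θ + t * w θ) (deriv (fun θ => u θ + t * w θ) θ) +
      G θ (u θ + -t * w θ) (deriv (fun θ => u θ + -t * w θ) θ) - 2 * G θ (u θ) (deriv u θ)) = 0 := by
    rw [intervalIntegral.integral_congr_Ioo_of_le (g := fun _ => (0 : ℝ)) (by linarith)]
    · simp
    · intro θ hθ
      have hev : w =ᶠ[𝓝 θ] fun _ => 0 := by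
        filter_upwards [Ioo_mem_nhds hθ.1 hθ.2] with s hs
        rw [hwv s ⟨by linarith [hs.1], hs.2⟩, hv0 s fun hm => by linarith [hm.2, hs.1]]
      have hev2 : ∀ r : ℝ, (fun θ => u θ + r * w θ) =ᶠ[𝓝 θ] u := fun r => by
        filter_upwards [hev] with s hs
        rw [hs]
        ring
      simp only [(hev2 t).deriv_eq, (hev2 (-t)).deriv_eq, hev.eq_of_nhds]
      ring_nf
  have hle : ∫ θ in α..β,
      (G θ (u θ + t * w θ) (deriv (fun θ => u θ + t * w θ) θ) +
      G θ (u θ + -t * w θ) (deriv (fun θ => u θ + -t * w θ) θ) - 2 * G θ (u θ) (deriv u θ)) ≤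
      ∫ θ in α..β, (C * t ^ 2 * v θ ^ 2 - K * t ^ 2 * deriv v θ ^ 2) := by
    refine intervalIntegral.integral_mono_ae_restrict hαβ.le (hfi α β)
      ((hi1.const_mul _).sub (hi2.const_mul _)) ?_
    refine (ae_restrict_iff' measurableSet_Icc).2 ?_
    filter_upwards [hLu.ae_differentiableAt, hLw.ae_differentiableAt, hsd] with θ h1 h2 h3 hθ
    have hwin : θ ∈ Ioo (β - 2 * Real.pi) (α + 2 * Real.pi) :=
      ⟨by linarith [hθ.1], by linarith [hθ.2]⟩
    have hd : ∀ r : ℝ, deriv (fun θ => u θ + r * w θ) θ = deriv u θ + r * deriv v θ := fun r => by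
      rw [← hwd θ hwin]
      exact (h1.hasDerivAt.add (h2.hasDerivAt.const_mul r)).deriv
    have hsmall : ∀ x : ℝ, |x| ≤ B → |t * x| < δ := fun x hx => by
      rw [abs_mul]
      exact (mul_le_mul_of_nonneg_left hx (abs_nonneg t)).trans_lt htδ
    have hL0 : (0 : ℝ) ≤ L := L.2
    have hLβ : 0 ≤ (L : ℝ) * (β - α) := mul_nonneg L.2 (by linarith)
    have := h3 ⟨by linarith [hθ.1], by linarith [hθ.2]⟩ (t * v θ) (t * deriv v θ)
      (hsmall _ ((hvB θ).trans (by linarith)))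
      (hsmall _ ((abs_deriv_le_of_lipschitz hv θ).trans (by linarith)))
    rw [hd, hd, hwv θ hwin]
    simp only [neg_mul, ← sub_eq_add_neg]
    refine this.trans (le_of_eq ?_)
    ring
  rw [hzero, add_zero]
  rw [intervalIntegral.integral_sub (hi1.const_mul _) (hi2.const_mul _),
    intervalIntegral.integral_const_mul, intervalIntegral.integral_const_mul] at hle
  have ht2 : 0 < t ^ 2 := by
    rw [← sq_abs]
    positivity
  have := mul_neg_of_pos_of_neg ht2 hquad
  linarith

/-! ### Improving perturbations near an accumulation point of the curvature -/

/-- Near an accumulation point of the support of the curvature there are two-sided admissible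
perturbations along which the functional decreases to second order. -/
theorem StronglyConcaveAlong.exists_improving {G : ℝ → ℝ → ℝ → ℝ}
    (hG : ContDiff ℝ 2 (fun x : ℝ × ℝ × ℝ => G x.1 x.2.1 x.2.2))
    (hper : ∀ θ u p : ℝ, G (θ + 2 * Real.pi) u p = G θ u p)
    {u U : ℝ → ℝ} {H : StieltjesFunction ℝ} (hu : W1inf u) (h : CurvaturePrimitive u U H)
    (hconc : StronglyConcaveAlong G u) {ρ : ℝ → ℝ} (hρ : Continuous ρ) (D : ℝ) {γ₁ γ₂ : ℝ}
    (hinf : (H.measure.support ∩ Ioo γ₁ γ₂).Infinite) :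
    ∃ (α β : ℝ) (v : ℝ → ℝ) (L : ℝ≥0), γ₁ < α ∧ α < β ∧ β < γ₂ ∧ β < α + 2 * Real.pi ∧
      LipschitzWith L v ∧ (∀ θ, θ ∉ Ioo α β → v θ = 0) ∧ ∫ θ in α..β, ρ θ * v θ = 0 ∧
      ∃ t₀ > 0, ∀ t, 0 < |t| → |t| ≤ t₀ →
        ConvexityConstraint (fun θ => u θ + t * periodize α v θ) ∧
        functional G (fun θ => u θ + t * periodize α v θ) +
          functional G (fun θ => u θ + -t * periodize α v θ) - 2 * functional G u +
          D * (t ^ 2 * ∫ θ in α..β, v θ ^ 2) < 0 := by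
  obtain ⟨θ₀, -, hacc⟩ := hinf.exists_accPt_of_subset_isCompact isCompact_Icc
    (inter_subset_right.trans Ioo_subset_Icc_self)
  obtain ⟨η, hη, hηπ, hsv⟩ := hconc.second_variation_neg hG hper hu h θ₀ D
  have hinf' := Set.Infinite.of_accPt
    (hacc.nhds_inter (Ioo_mem_nhds (a := θ₀ - η) (b := θ₀ + η) (by linarith) (by linarith)))
  obtain ⟨s, hs, hcard⟩ := hinf'.exists_subset_card_eq 6
  -- the midpoints of six points of the support are separated by points of the support
  set e := s.orderEmbOfFin hcard with he
  have hes : ∀ i, e i ∈ Ioo (θ₀ - η) (θ₀ + η) ∩ (H.measure.support ∩ Ioo γ₁ γ₂) := fun i =>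
    hs (s.orderEmbOfFin_mem hcard i)
  set q : Fin 5 → ℝ := fun i => (e i.castSucc + e i.succ) / 2 with hq
  have hlt : ∀ i : Fin 5, e i.castSucc < e i.succ := fun i => e.strictMono i.castSucc_lt_succ
  have hHq : StrictMono (H ∘ q) := by
    refine Fin.strictMono_iff_lt_succ.2 fun i => ?_
    refine stieltjes_lt_of_mem_support (hes i.succ.castSucc).2.1 ?_ ?_
    · have := hlt i.castSucc
      simp only [hq, Fin.succ_castSucc] at this ⊢
      linarith
    · have := hlt i.succ
      simp only [hq]
      linarith
  have hq0 : e 0 < q 0 := by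
    have := hlt 0
    simp only [hq, Fin.castSucc_zero] at this ⊢
    linarith
  have hq4 : q 4 < e 5 := by
    have := hlt 4
    have e5 : (4 : Fin 5).succ = 5 := rfl
    simp only [hq, e5] at this ⊢
    linarith
  have h0 := hes 0
  have h5 := hes 5
  have hq04 : q 0 < q 4 := by
    by_contra hcon
    exact absurd (H.mono (not_lt.1 hcon)) (not_le.2 (hHq (show (0 : Fin 5) < 4 by decide)))
  have hlen : q 4 < q 0 + 2 * Real.pi := by linarith [h0.1.1, h5.1.2]
  obtain ⟨v, ⟨L, hL⟩, hne, hv0, hvρ, t₀, ht₀, hconv⟩ := h.exists_perturbation hu hρ hHq hlen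
  obtain ⟨t₁, ht₁, hneg⟩ := hsv (q 0) (q 4) (by linarith [h0.1.1]) hq04 (by linarith [h5.1.2])
    v L hL hne hv0
  exact ⟨q 0, q 4, v, L, by linarith [h0.2.2.1], hq04, by linarith [h5.2.2.2], hlen, hL, hv0, hvρ,
    min t₀ t₁, lt_min ht₀ ht₁, fun t h1 h2 =>
      ⟨hconv t (h2.trans (min_le_left _ _)), hneg t h1 (h2.trans (min_le_right _ _))⟩⟩

/-! ### The annulus constraint -/

theorem finite_support_of_annulus {G : ℝ → ℝ → ℝ → ℝ}
    (hG : ContDiff ℝ 2 (fun x : ℝ × ℝ × ℝ => G x.1 x.2.1 x.2.2))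
    (hper : ∀ θ u p : ℝ, G (θ + 2 * Real.pi) u p = G θ u p)
    {u U : ℝ → ℝ} {H : StieltjesFunction ℝ} (h : CurvaturePrimitive u U H)
    (hconc : StronglyConcaveAlong G u) {a b : ℝ} (hsol : IsSolution G (annulusClass a b) u)
    {γ₁ γ₂ : ℝ} (hγ : Ioo γ₁ γ₂ ⊆ {θ | a < u θ ∧ u θ < b}) :
    (H.measure.support ∩ Ioo γ₁ γ₂).Finite := by
  by_contra hinf
  obtain ⟨⟨hu, -, hab⟩, hmin⟩ := hsol
  -- strict inequality constraints need no orthogonality and no compensation: `ρ = 0` and `D = 0`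
  obtain ⟨α, β, v, L, h1, hαβ, h2, hlen, hL, hv0, -, t₀, ht₀, ht⟩ :=
    hconc.exists_improving hG hper hu h (continuous_const (y := (0 : ℝ))) 0 hinf
  have hsub : Icc α β ⊆ Ioo γ₁ γ₂ := fun θ hθ => ⟨h1.trans_le hθ.1, hθ.2.trans_lt h2⟩
  obtain ⟨θm, hθm, hm⟩ := isCompact_Icc.exists_isMinOn (nonempty_Icc.2 hαβ.le)
    hu.continuous.continuousOn
  obtain ⟨θM, hθM, hM⟩ := isCompact_Icc.exists_isMaxOn (nonempty_Icc.2 hαβ.le)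
    hu.continuous.continuousOn
  set m := min (u θm - a) (b - u θM) with hmdef
  have hm0 : 0 < m := lt_min (sub_pos.2 (hγ (hsub hθm)).1) (sub_pos.2 (hγ (hsub hθM)).2)
  set B := L * (β - α) + 1 with hB
  have hB0 : 0 < B := by
    have : 0 ≤ (L : ℝ) * (β - α) := mul_nonneg L.2 (by linarith)
    linarith
  set t := min t₀ (m / B) with htdef
  have ht0 : 0 < t := lt_min ht₀ (by positivity)
  have htB : t * B ≤ m := by
    have : t ≤ m / B := min_le_right _ _
    rwa [le_div_iff₀ hB0] at this
  have hw : W1inf (periodize α v) := periodize_W1inf hL (hv0 _ fun hm => lt_irrefl _ hm.1)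
    (hv0 _ fun hm => by linarith [hm.2])
  have hclass : ∀ r, |r| = t → (fun θ => u θ + r * periodize α v θ) ∈ annulusClass a b := by
    intro r hr
    refine ⟨hu.add (hw.const_mul r),
      (ht r (by rw [hr]; exact ht0) (by rw [hr]; exact min_le_left _ _)).1, fun θ => ?_⟩
    have e1 : u θ = u (toIcoMod Real.two_pi_pos α θ) := by
      conv_lhs => rw [← toIcoMod_add_toIcoDiv_zsmul Real.two_pi_pos α θ]
      exact hu.periodic.zsmul _ _
    simp only [periodize]
    rw [e1]
    set x := toIcoMod Real.two_pi_pos α θ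
    by_cases hx : x ∈ Ioo α β
    · have hx' : x ∈ Icc α β := Ioo_subset_Icc_self hx
      have h3 : u θm ≤ u x := hm hx'
      have h4 : u x ≤ u θM := hM hx'
      have h5 : |r * v x| ≤ m := by
        rw [abs_mul, hr]
        refine (mul_le_mul_of_nonneg_left ?_ ht0.le).trans htB
        exact (abs_le_of_lipschitz hL hαβ.le hv0 x).trans (by linarith)
      have h6 := abs_le.1 h5
      have h7 : m ≤ u θm - a := min_le_left _ _
      have h8 : m ≤ b - u θM := min_le_right _ _
      constructor <;> linarith
    · rw [hv0 x hx, mul_zero, add_zero]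
      exact hab x
  have key := (ht t (by rwa [abs_of_pos ht0])
    (by rw [abs_of_pos ht0]; exact min_le_left _ _)).2
  have k1 := hmin _ (hclass t (abs_of_pos ht0))
  have k2 := hmin _ (hclass (-t) (by rw [abs_neg, abs_of_pos ht0]))
  rw [zero_mul, add_zero] at key
  linarith

/-! ### The area constraint -/

theorem area_eq {u : ℝ → ℝ} (hu : Continuous u) (hpos : ∀ θ, 0 < u θ) :
    area u = ENNReal.ofReal (1 / 2 * ∫ θ in (0 : ℝ)..(2 * Real.pi), (u θ ^ 2)⁻¹) := by
  have hc : Continuous fun θ => (u θ ^ 2)⁻¹ := (hu.pow 2).inv₀ fun θ => (pow_pos (hpos θ) 2).ne'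
  unfold area
  rw [ENNReal.ofReal_mul (by norm_num), intervalIntegral.integral_of_le Real.two_pi_pos.le,
    ← integral_Icc_eq_integral_Ioc, integral_Icc_eq_integral_Ico,
    ofReal_integral_eq_lintegral_ofReal
      ((hc.continuousOn.integrableOn_compact isCompact_Icc).mono_set Ico_subset_Icc_self)
      (ae_of_all _ fun θ => by positivity)]
  congr 1
  · rw [one_div, ENNReal.ofReal_inv_of_pos (by norm_num)]
    norm_num
  · refine lintegral_congr fun θ => ?_
    rw [ENNReal.ofReal_inv_of_pos (pow_pos (hpos θ) 2)]

/-- Second-order Taylor bounds for `x ↦ x⁻²`. -/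
theorem inv_sq_taylor {d x y : ℝ} (hd : 0 < d) (hx : d ≤ x) (hy : d ≤ y) :
    0 ≤ (x ^ 2)⁻¹ - (y ^ 2)⁻¹ + 2 * (x - y) * (y ^ 3)⁻¹ ∧
      (x ^ 2)⁻¹ - (y ^ 2)⁻¹ + 2 * (x - y) * (y ^ 3)⁻¹ ≤ 3 / d ^ 4 * (x - y) ^ 2 := by
  have hx0 : 0 < x := hd.trans_le hx
  have hy0 : 0 < y := hd.trans_le hy
  have e : (x ^ 2)⁻¹ - (y ^ 2)⁻¹ + 2 * (x - y) * (y ^ 3)⁻¹ =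
      (2 / (x * y ^ 3) + 1 / (x ^ 2 * y ^ 2)) * (x - y) ^ 2 := by
    field_simp
    ring
  rw [e]
  refine ⟨by positivity, mul_le_mul_of_nonneg_right ?_ (sq_nonneg _)⟩
  have h1 : d ^ 4 ≤ x * y ^ 3 := by
    calc d ^ 4 = d * d ^ 3 := by ring
      _ ≤ x * y ^ 3 := mul_le_mul hx (pow_le_pow_left₀ hd.le hy 3) (by positivity) hx0.le
  have h2 : d ^ 4 ≤ x ^ 2 * y ^ 2 := by
    calc d ^ 4 = d ^ 2 * d ^ 2 := by ring
      _ ≤ x ^ 2 * y ^ 2 := mul_le_mul (pow_le_pow_left₀ hd.le hx 2) (pow_le_pow_left₀ hd.le hy 2)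
        (by positivity) (by positivity)
  have h3 : 2 / (x * y ^ 3) ≤ 2 / d ^ 4 := div_le_div_of_nonneg_left (by norm_num) (by positivity) h1
  have h4 : 1 / (x ^ 2 * y ^ 2) ≤ 1 / d ^ 4 :=
    div_le_div_of_nonneg_left (by norm_num) (by positivity) h2
  have h5 : 3 / d ^ 4 = 2 / d ^ 4 + 1 / d ^ 4 := by ring
  linarith

theorem ConvexityConstraint.const_mul {u : ℝ → ℝ} (hc : ConvexityConstraint u) {c : ℝ}
    (hc0 : 0 ≤ c) : ConvexityConstraint (fun θ => c * u θ) := by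
  intro w hw hw0
  have : ∀ θ, c * u θ * w θ - deriv (fun θ => c * u θ) θ * deriv w θ =
      c * (u θ * w θ - deriv u θ * deriv w θ) := fun θ => by
    rw [deriv_const_mul_field]
    ring
  simp only [this]
  rw [intervalIntegral.integral_const_mul]
  exact mul_nonneg hc0 (hc w hw hw0)

/-- The functional is Lipschitz under scaling, uniformly over bounded sets of `W^{1,∞}`. -/
theorem exists_functional_scaling_le {G : ℝ → ℝ → ℝ → ℝ}
    (hG : ContDiff ℝ 2 (fun x : ℝ × ℝ × ℝ => G x.1 x.2.1 x.2.2)) (R : ℝ) :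
    ∃ M ≥ 0, ∀ u : ℝ → ℝ, W1inf u → (∀ θ, |u θ| ≤ R) → (∀ θ, |deriv u θ| ≤ R) →
      ∀ c : ℝ, 1 ≤ c → c ≤ 2 →
        functional G (fun θ => c * u θ) ≤ functional G u + M * (c - 1) := by
  have hloc := ((hG.of_le (by norm_num) : ContDiff ℝ 1 _).locallyLipschitz).locallyLipschitzOn
    (s := Icc (0 : ℝ) (2 * Real.pi) ×ˢ (Icc (-(2 * R)) (2 * R) ×ˢ Icc (-(2 * R)) (2 * R)))
  obtain ⟨K, hK⟩ := hloc.exists_lipschitzOnWith_of_compact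
    (isCompact_Icc.prod (isCompact_Icc.prod isCompact_Icc))
  refine ⟨2 * Real.pi * (K * |R|), by positivity, fun u hu hR hR' c hc1 hc2 => ?_⟩
  have hR0 : 0 ≤ R := (abs_nonneg _).trans (hR 0)
  have hcu := hu.const_mul c
  have hi0 := intervalIntegrable_integrand hG.continuous hu 0 (2 * Real.pi)
  have hic := intervalIntegrable_integrand hG.continuous hcu 0 (2 * Real.pi)
  have : functional G (fun θ => c * u θ) ≤
      ∫ θ in (0 : ℝ)..(2 * Real.pi), (G θ (u θ) (deriv u θ) + K * |R| * (c - 1)) := by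
    refine intervalIntegral.integral_mono_on Real.two_pi_pos.le hic (hi0.add (by simp))
      fun θ hθ => ?_
    rw [deriv_const_mul_field]
    have hin : ∀ x : ℝ, |x| ≤ R → x ∈ Icc (-(2 * R)) (2 * R) ∧ c * x ∈ Icc (-(2 * R)) (2 * R) ∧
        |c * x - x| ≤ (c - 1) * |R| := fun x hx => by
      have e1 : |c * x| ≤ 2 * R := by
        rw [abs_mul, abs_of_nonneg (by linarith : 0 ≤ c)]
        exact mul_le_mul hc2 hx (abs_nonneg _) (by norm_num)
      refine ⟨abs_le.1 (by linarith), abs_le.1 e1, ?_⟩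
      rw [show c * x - x = (c - 1) * x by ring, abs_mul, abs_of_nonneg (by linarith : 0 ≤ c - 1),
        abs_of_nonneg hR0]
      exact mul_le_mul_of_nonneg_left hx (by linarith)
    obtain ⟨a1, a2, a3⟩ := hin _ (hR θ)
    obtain ⟨b1, b2, b3⟩ := hin _ (hR' θ)
    have hdist := hK.dist_le_mul (θ, c * u θ, c * deriv u θ) ⟨hθ, a2, b2⟩
      (θ, u θ, deriv u θ) ⟨hθ, a1, b1⟩
    have hd2 : dist (θ, c * u θ, c * deriv u θ) (θ, u θ, deriv u θ) ≤ (c - 1) * |R| := by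
      rw [Prod.dist_eq, Prod.dist_eq, dist_self]
      exact max_le (mul_nonneg (by linarith) (abs_nonneg _)) (max_le a3 b3)
    have h3 := hdist.trans (mul_le_mul_of_nonneg_left hd2 K.2)
    rw [Real.dist_eq] at h3
    have h4 := (abs_le.1 h3).2
    change G θ (c * u θ) (c * deriv u θ) - G θ (u θ) (deriv u θ) ≤ K * ((c - 1) * |R|) at h4
    linarith
  refine this.trans (le_of_eq ?_)
  rw [intervalIntegral.integral_add hi0 (by simp), intervalIntegral.integral_const]
  simp only [functional, smul_eq_mul]
  ring

/-- The competitors are `c (u ± t v)`, where the scaling factor `c` restores the area. As the first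
variation of the area vanishes along `v`, it differs from `1` by `O(t² ∫ v²)`, and rescaling does
not offset the negative second variation. -/
theorem finite_support_of_area {G : ℝ → ℝ → ℝ → ℝ}
    (hG : ContDiff ℝ 2 (fun x : ℝ × ℝ × ℝ => G x.1 x.2.1 x.2.2))
    (hper : ∀ θ u p : ℝ, G (θ + 2 * Real.pi) u p = G θ u p)
    {u U : ℝ → ℝ} {H : StieltjesFunction ℝ} (h : CurvaturePrimitive u U H)
    (hconc : StronglyConcaveAlong G u) {m₀ : ℝ} (hm₀ : 0 < m₀) (hpos : ∀ θ, 0 < u θ)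
    (hsol : IsSolution G (areaClass m₀) u) (γ₁ γ₂ : ℝ) :
    (H.measure.support ∩ Ioo γ₁ γ₂).Finite := by
  by_contra hinf
  obtain ⟨⟨hu, -, harea⟩, hmin⟩ := hsol
  have huc := hu.continuous
  have hpi := Real.two_pi_pos
  obtain ⟨Lu, hLu⟩ := hu.1
  have hred : ∀ θ, u θ = u (toIcoMod Real.two_pi_pos 0 θ) := fun θ => by
    conv_lhs => rw [← toIcoMod_add_toIcoDiv_zsmul Real.two_pi_pos 0 θ]
    exact hu.periodic.zsmul _ _
  have hmem : ∀ θ, toIcoMod Real.two_pi_pos 0 θ ∈ Icc 0 (2 * Real.pi) := fun θ => by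
    have := toIcoMod_mem_Ico Real.two_pi_pos 0 θ
    rw [zero_add] at this
    exact Ico_subset_Icc_self this
  obtain ⟨θm, -, hm⟩ := isCompact_Icc.exists_isMinOn (nonempty_Icc.2 hpi.le) huc.continuousOn
  obtain ⟨θM, -, hM⟩ := isCompact_Icc.exists_isMaxOn (nonempty_Icc.2 hpi.le) huc.continuousOn
  have hlow : ∀ θ, u θm ≤ u θ := fun θ => by rw [hred θ]; exact hm (hmem θ)
  have hupp : ∀ θ, u θ ≤ u θM := fun θ => by rw [hred θ]; exact hM (hmem θ)
  set d := u θm / 2 with hd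
  have hd0 : 0 < d := half_pos (hpos θm)
  have hud : ∀ θ, 2 * d ≤ u θ := fun θ => by rw [hd]; linarith [hlow θ]
  set R : ℝ := u θM + Lu + 1 with hR
  obtain ⟨M, hM0, hscale⟩ := exists_functional_scaling_le hG R
  set C₂ : ℝ := 1 / 2 * (3 / d ^ 4) / m₀ with hC₂
  have hC₂0 : 0 < C₂ := by positivity
  have hρ : Continuous fun θ => (u θ ^ 3)⁻¹ :=
    (huc.pow 3).inv₀ fun θ => (pow_pos (hpos θ) 3).ne'
  obtain ⟨α, β, v, L, -, hαβ, -, hlen, hL, hv0, horth, t₀, ht₀, ht⟩ :=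
    hconc.exists_improving hG hper hu h hρ (2 * (M * C₂)) hinf
  set w := periodize α v with hwdef
  have hw : W1inf w := periodize_W1inf hL (hv0 _ fun hm => lt_irrefl _ hm.1)
    (hv0 _ fun hm => by linarith [hm.2])
  obtain ⟨Lw, hLw⟩ := hw.1
  have hwv : ∀ θ ∈ Ioo (β - 2 * Real.pi) (α + 2 * Real.pi), w θ = v θ := fun θ hθ =>
    periodize_eq hαβ.le (fun s hs => hv0 s fun hm => hs ⟨hm.1.le, hm.2.le⟩) hθ
  have hLβ : 0 ≤ (L : ℝ) * (β - α) := mul_nonneg L.2 (by linarith)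
  have hwB : ∀ θ, |w θ| ≤ L * (β - α) := fun θ => abs_le_of_lipschitz hL hαβ.le hv0 _
  set I := ∫ θ in α..β, v θ ^ 2 with hI
  have hI0 : 0 ≤ I := intervalIntegral.integral_nonneg hαβ.le fun _ _ => sq_nonneg _
  set B : ℝ := L * (β - α) + Lw + 1 with hB
  have hLw0 : (0 : ℝ) ≤ Lw := Lw.2
  have hLu0 : (0 : ℝ) ≤ Lu := Lu.2
  have hB0 : 0 < B := by linarith
  obtain ⟨t, htpos, htt₀, htd, ht1, htI⟩ : ∃ t > 0, t ≤ t₀ ∧ t * B ≤ d ∧ t * B ≤ 1 ∧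
      C₂ * (t ^ 2 * I) ≤ 1 := by
    have hcont : ∀ᶠ t in 𝓝[>] (0 : ℝ), C₂ * (t ^ 2 * I) < 1 := by
      have hc : Continuous fun t : ℝ => C₂ * (t ^ 2 * I) := by fun_prop
      exact nhdsWithin_le_nhds (hc.continuousAt.eventually_lt continuousAt_const (by simp))
    obtain ⟨t, h1, h2⟩ := (hcont.and (Ioo_mem_nhdsGT
      (lt_min ht₀ (lt_min (div_pos hd0 hB0) (div_pos one_pos hB0))))).exists
    have h3 := h2.2.le
    refine ⟨t, h2.1, h3.trans (min_le_left _ _), ?_, ?_, h1.le⟩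
    · have := h3.trans ((min_le_right _ _).trans (min_le_left _ _))
      rwa [le_div_iff₀ hB0] at this
    · have := h3.trans ((min_le_right _ _).trans (min_le_right _ _))
      rwa [le_div_iff₀ hB0] at this
  have hm₀eq : 1 / 2 * ∫ θ in (0 : ℝ)..(2 * Real.pi), (u θ ^ 2)⁻¹ = m₀ := by
    rw [area_eq huc hpos] at harea
    refine (ENNReal.ofReal_eq_ofReal_iff ?_ hm₀.le).1 harea
    exact mul_nonneg (by norm_num)
      (intervalIntegral.integral_nonneg hpi.le fun θ _ => by positivity)
  have hcomp : ∀ r, |r| = t →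
      functional G u ≤ functional G (fun θ => u θ + r * w θ) + M * (C₂ * (t ^ 2 * I)) := by
    intro r hr
    set z : ℝ → ℝ := fun θ => u θ + r * w θ with hz
    have hzW : W1inf z := hu.add (hw.const_mul r)
    have hzc := hzW.continuous
    have hrw : ∀ θ, |r * w θ| ≤ t * (L * (β - α)) := fun θ => by
      rw [abs_mul, hr]
      exact mul_le_mul_of_nonneg_left (hwB θ) htpos.le
    have htL : t * (L * (β - α)) ≤ t * B := mul_le_mul_of_nonneg_left (by linarith) htpos.le
    have hzd : ∀ θ, d ≤ z θ := fun θ => by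
      have := (abs_le.1 (hrw θ)).1
      simp only [hz]
      linarith [hud θ]
    have hzpos : ∀ θ, 0 < z θ := fun θ => hd0.trans_le (hzd θ)
    -- the area of the perturbation
    set A := 1 / 2 * ∫ θ in (0 : ℝ)..(2 * Real.pi), (z θ ^ 2)⁻¹ with hA
    have hcz : Continuous fun θ => (z θ ^ 2)⁻¹ :=
      (hzc.pow 2).inv₀ fun θ => (pow_pos (hzpos θ) 2).ne'
    have hcu : Continuous fun θ => (u θ ^ 2)⁻¹ :=
      (huc.pow 2).inv₀ fun θ => (pow_pos (hpos θ) 2).ne'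
    set E : ℝ → ℝ := fun θ => (z θ ^ 2)⁻¹ - (u θ ^ 2)⁻¹ with hE
    have hEc : Continuous E := hcz.sub hcu
    have hEper : Function.Periodic E (2 * Real.pi) := fun θ => by
      simp only [hE, hzW.periodic θ, hu.periodic θ]
    have hAE : A - m₀ = 1 / 2 * ∫ θ in α..β, E θ := by
      rw [hA, ← hm₀eq, ← mul_sub, ← intervalIntegral.integral_sub (hcz.intervalIntegrable _ _)
        (hcu.intervalIntegrable _ _)]
      change 1 / 2 * (∫ θ in (0 : ℝ)..2 * Real.pi, E θ) = _
      have e1 := hEper.intervalIntegral_add_eq 0 α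
      rw [zero_add] at e1
      rw [e1, ← intervalIntegral.integral_add_adjacent_intervals (hEc.intervalIntegrable α β)
        (hEc.intervalIntegrable β _)]
      have e2 : ∫ θ in β..α + 2 * Real.pi, E θ = 0 := by
        rw [intervalIntegral.integral_congr_Ioo_of_le (g := fun _ => (0 : ℝ)) (by linarith)]
        · simp
        · intro θ hθ
          simp only [hE, hz]
          rw [hwv θ ⟨by linarith [hθ.1], hθ.2⟩, hv0 θ fun hm => by linarith [hm.2, hθ.1]]
          simp
      rw [e2, add_zero]
    have hvc := hL.continuous
    have hTay : ∀ θ ∈ Icc α β, 0 ≤ E θ + 2 * r * ((u θ ^ 3)⁻¹ * v θ) ∧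
        E θ + 2 * r * ((u θ ^ 3)⁻¹ * v θ) ≤ 3 / d ^ 4 * (t ^ 2 * v θ ^ 2) := fun θ hθ => by
      have hwin : θ ∈ Ioo (β - 2 * Real.pi) (α + 2 * Real.pi) :=
        ⟨by linarith [hθ.1], by linarith [hθ.2]⟩
      have := inv_sq_taylor hd0 (hzd θ) (by linarith [hud θ] : d ≤ u θ)
      have e1 : z θ - u θ = r * v θ := by simp only [hz, hwv θ hwin]; ring
      rw [e1] at this
      have e2 : (r * v θ) ^ 2 = t ^ 2 * v θ ^ 2 := by rw [mul_pow, ← sq_abs r, hr]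
      rw [e2] at this
      have e3 : 2 * r * ((u θ ^ 3)⁻¹ * v θ) = 2 * (r * v θ) * (u θ ^ 3)⁻¹ := by ring
      rw [e3]
      exact this
    have hci : Continuous fun θ => (u θ ^ 3)⁻¹ * v θ := hρ.mul hvc
    have hEint : ∫ θ in α..β, E θ = ∫ θ in α..β, (E θ + 2 * r * ((u θ ^ 3)⁻¹ * v θ)) := by
      rw [intervalIntegral.integral_add (hEc.intervalIntegrable _ _)
        ((hci.const_mul _).intervalIntegrable _ _), intervalIntegral.integral_const_mul, horth,
        mul_zero, add_zero]
    have hAm : m₀ ≤ A := by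
      have : 0 ≤ ∫ θ in α..β, E θ := by
        rw [hEint]
        exact intervalIntegral.integral_nonneg hαβ.le fun θ hθ => (hTay θ hθ).1
      linarith
    have hAu : A - m₀ ≤ 1 / 2 * (3 / d ^ 4) * (t ^ 2 * I) := by
      have : ∫ θ in α..β, E θ ≤ ∫ θ in α..β, 3 / d ^ 4 * (t ^ 2 * v θ ^ 2) := by
        rw [hEint]
        refine intervalIntegral.integral_mono_on hαβ.le
          ((hEc.add (hci.const_mul _)).intervalIntegrable _ _)
          ((((hvc.pow 2).const_mul _).const_mul _).intervalIntegrable _ _)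
          fun θ hθ => (hTay θ hθ).2
      rw [intervalIntegral.integral_const_mul, intervalIntegral.integral_const_mul] at this
      rw [hAE, mul_assoc]
      linarith
    -- the scaling factor
    set c := Real.sqrt (A / m₀) with hc
    have hAm1 : 1 ≤ A / m₀ := (one_le_div hm₀).2 hAm
    have hc1 : 1 ≤ c := Real.one_le_sqrt.2 hAm1
    have hcsq : c ^ 2 = A / m₀ := Real.sq_sqrt (by linarith)
    have hc0 : 0 < c := by linarith
    have hcle : c - 1 ≤ C₂ * (t ^ 2 * I) := by
      have h1 : c - 1 ≤ c ^ 2 - 1 := by nlinarith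
      have h2 : c ^ 2 - 1 = (A - m₀) / m₀ := by
        rw [hcsq]
        field_simp
      have h3 : (A - m₀) / m₀ ≤ 1 / 2 * (3 / d ^ 4) * (t ^ 2 * I) / m₀ :=
        div_le_div_of_nonneg_right hAu hm₀.le
      refine (h1.trans (h2.le.trans h3)).trans (le_of_eq ?_)
      rw [hC₂]
      ring
    have hclass : (fun θ => c * z θ) ∈ areaClass m₀ := by
      refine ⟨hzW.const_mul c,
        ((ht r (by rw [hr]; exact htpos) (by rw [hr]; exact htt₀)).1).const_mul hc0.le, ?_⟩
      rw [area_eq (hzc.const_mul c) fun θ => mul_pos hc0 (hzpos θ)]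
      congr 1
      have : ∀ θ, ((c * z θ) ^ 2)⁻¹ = (c ^ 2)⁻¹ * (z θ ^ 2)⁻¹ := fun θ => by
        rw [mul_pow, mul_inv]
      simp only [this]
      rw [intervalIntegral.integral_const_mul, mul_left_comm, ← hA, hcsq]
      have : A ≠ 0 := (hm₀.trans_le hAm).ne'
      field_simp
    have hz1 : ∀ θ, |z θ| ≤ R := fun θ => by
      have h1 := (abs_le.1 (hrw θ)).2
      rw [abs_of_pos (hzpos θ)]
      simp only [hz]
      linarith [hupp θ]
    have hz2 : ∀ θ, |deriv z θ| ≤ R := fun θ => by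
      have hzL : LipschitzWith (Lu + ‖r‖₊ * Lw) z := hLu.add ((lipschitzWith_smul r).comp hLw)
      refine (abs_deriv_le_of_lipschitz hzL θ).trans ?_
      have : ((Lu + ‖r‖₊ * Lw : ℝ≥0) : ℝ) = Lu + t * Lw := by
        push_cast
        rw [Real.norm_eq_abs, hr]
      rw [this]
      have h1 : t * Lw ≤ t * B := mul_le_mul_of_nonneg_left (by linarith) htpos.le
      linarith [hpos θM]
    have hfin := hscale z hzW hz1 hz2 c hc1 (by linarith)
    have h1 := hmin _ hclass
    have h2 : M * (c - 1) ≤ M * (C₂ * (t ^ 2 * I)) := mul_le_mul_of_nonneg_left hcle hM0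
    linarith
  have key := (ht t (by rwa [abs_of_pos htpos]) (by rwa [abs_of_pos htpos])).2
  have k1 := hcomp t (abs_of_pos htpos)
  have k2 := hcomp (-t) (by rw [abs_neg, abs_of_pos htpos])
  linarith

/-! ### Supporting sinusoids -/

/-- Variation of constants for `u'' + u = dH`. -/
theorem CurvaturePrimitive.representation {u U : ℝ → ℝ} {H : StieltjesFunction ℝ}
    (h : CurvaturePrimitive u U H) (φ θ : ℝ) :
    u θ = u φ * Real.cos (θ - φ) + (H φ - U φ) * Real.sin (θ - φ) +
      ∫ s in φ..θ, (H s - H φ) * Real.cos (θ - s) := by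
  have hcos : Continuous fun s => Real.cos (θ - s) := by fun_prop
  have hsin : Continuous fun s => Real.sin (θ - s) := by fun_prop
  have hdc : ∀ s, HasDerivAt (fun s => Real.cos (θ - s)) (Real.sin (θ - s)) s := fun s =>
    ((Real.hasDerivAt_cos (θ - s)).comp s ((hasDerivAt_id s).const_sub θ)).congr_deriv (by simp)
  have hds : ∀ s, HasDerivAt (fun s => Real.sin (θ - s)) (-Real.cos (θ - s)) s := fun s =>
    ((Real.hasDerivAt_sin (θ - s)).comp s ((hasDerivAt_id s).const_sub θ)).congr_deriv (by simp)
  have hHi : IntervalIntegrable (fun s => (H s - H φ) * Real.cos (θ - s)) volume φ θ :=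
    ((h.intervalIntegrable φ θ).sub (by simp)).mul_continuousOn hcos.continuousOn
  have key := intervalIntegral.integral_eq_sub_of_hasDeriv_right (a := φ) (b := θ)
    (f := fun s => u s * Real.cos (θ - s) - U s * Real.sin (θ - s) + H φ * Real.sin (θ - s))
    (f' := fun s => (H s - H φ) * Real.cos (θ - s))
    (((h.continuous.mul hcos).sub (h.continuous_primitive.mul hsin)).add
      (hsin.const_mul _)).continuousOn
    (fun s _ => by
      refine ((((h.hasDerivWithinAt_Ioi s).mul (hdc s).hasDerivWithinAt).sub
        ((h.hasDerivAt s).hasDerivWithinAt.mul (hds s).hasDerivWithinAt)).add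
        ((hds s).hasDerivWithinAt.const_mul (H φ))).congr_deriv ?_
      ring)
    hHi
  simp only [sub_self, Real.cos_zero, Real.sin_zero] at key
  linarith

/-- A function with `u'' + u ≥ 0` lies above the sinusoid that touches it at `φ`. -/
theorem CurvaturePrimitive.sinusoid_le {u U : ℝ → ℝ} {H : StieltjesFunction ℝ} (hu : W1inf u)
    (h : CurvaturePrimitive u U H) (φ θ : ℝ) :
    u φ * Real.cos (θ - φ) + (H φ - U φ) * Real.sin (θ - φ) ≤ u θ := by
  have near : ∀ θ, φ - Real.pi ≤ θ → θ ≤ φ + Real.pi →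
      u φ * Real.cos (θ - φ) + (H φ - U φ) * Real.sin (θ - φ) ≤ u θ := by
    intro θ h1 h2
    have hcos : Continuous fun s => Real.cos (θ - s) := by fun_prop
    have hint : ∀ c a b, IntervalIntegrable (fun s => (H s - c) * Real.cos (θ - s)) volume a b :=
      fun c a b => ((h.intervalIntegrable a b).sub (by simp)).mul_continuousOn hcos.continuousOn
    have hintc : ∀ a b, ∫ s in a..b, Real.cos (θ - s) = Real.sin (θ - a) - Real.sin (θ - b) :=
      fun a b => by
        rw [intervalIntegral.integral_comp_sub_left (fun s => Real.cos s), integral_cos]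
    rw [h.representation φ θ]
    refine le_add_of_nonneg_right ?_
    -- compare `H s` with its value at the point `s₀` where `cos (θ - s)` changes sign
    have split : ∀ s₀, ∫ s in φ..θ, (H s - H φ) * Real.cos (θ - s) =
        (∫ s in φ..θ, (H s - H s₀) * Real.cos (θ - s)) +
          (H s₀ - H φ) * Real.sin (θ - φ) := fun s₀ => by
      have e := hintc φ θ
      rw [sub_self, Real.sin_zero, sub_zero] at e
      rw [← e, ← intervalIntegral.integral_const_mul, ← intervalIntegral.integral_add (hint _ _ _)
        ((hcos.const_mul _).intervalIntegrable _ _)]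
      congr 1
      funext s
      ring
    rcases le_total φ θ with hle | hle
    · have hsin : 0 ≤ Real.sin (θ - φ) := Real.sin_nonneg_of_nonneg_of_le_pi (by linarith)
        (by linarith)
      rw [split (max φ (θ - Real.pi / 2))]
      refine add_nonneg (intervalIntegral.integral_nonneg hle fun s hs => ?_)
        (mul_nonneg (sub_nonneg.2 (H.mono (le_max_left _ _))) hsin)
      rcases le_total (θ - Real.pi / 2) s with h3 | h3
      · exact mul_nonneg (sub_nonneg.2 (H.mono (max_le hs.1 h3)))
          (Real.cos_nonneg_of_neg_pi_div_two_le_of_le (by linarith [hs.2, Real.pi_pos])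
            (by linarith))
      · exact mul_nonneg_of_nonpos_of_nonpos
          (sub_nonpos.2 (H.mono (h3.trans (le_max_right _ _))))
          (Real.cos_nonpos_of_pi_div_two_le_of_le (by linarith) (by linarith [hs.1]))
    · have hsin : Real.sin (θ - φ) ≤ 0 := Real.sin_nonpos_of_nonpos_of_neg_pi_le (by linarith)
        (by linarith)
      rw [split (min φ (θ + Real.pi / 2))]
      refine add_nonneg ?_ (mul_nonneg_of_nonpos_of_nonpos
        (sub_nonpos.2 (H.mono (min_le_left _ _))) hsin)
      rw [intervalIntegral.integral_symm, ← intervalIntegral.integral_neg]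
      refine intervalIntegral.integral_nonneg hle fun s hs => ?_
      rw [← neg_mul, neg_sub, ← Real.cos_neg, neg_sub]
      rcases le_total s (θ + Real.pi / 2) with h3 | h3
      · exact mul_nonneg (sub_nonneg.2 (H.mono (le_min hs.2 h3)))
          (Real.cos_nonneg_of_neg_pi_div_two_le_of_le (by linarith [hs.1, Real.pi_pos])
            (by linarith))
      · exact mul_nonneg_of_nonpos_of_nonpos
          (sub_nonpos.2 (H.mono ((min_le_right _ _).trans h3)))
          (Real.cos_nonpos_of_pi_div_two_le_of_le (by linarith) (by linarith [hs.2]))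
  have hmem := toIcoMod_mem_Ico Real.two_pi_pos (φ - Real.pi) θ
  have heq := toIcoMod_add_toIcoDiv_zsmul Real.two_pi_pos (φ - Real.pi) θ
  set θ' := toIcoMod Real.two_pi_pos (φ - Real.pi) θ
  set n := toIcoDiv Real.two_pi_pos (φ - Real.pi) θ
  have := near θ' hmem.1 (by linarith [hmem.2])
  rw [← heq, hu.periodic.zsmul n θ', zsmul_eq_mul, add_sub_right_comm, Real.cos_add_int_mul_two_pi,
    Real.sin_add_int_mul_two_pi]
  exact this

/-- On an interval without curvature, `u` is a sinusoid, determined by its values at the ends. -/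
theorem CurvaturePrimitive.sin_mul_eq {u U : ℝ → ℝ} {H : StieltjesFunction ℝ}
    (h : CurvaturePrimitive u U H) {α β θ : ℝ} (hS : H.measure.support ∩ Ioo α β = ∅)
    (h1 : α ≤ θ) (h2 : θ ≤ β) :
    Real.sin (β - α) * u θ = Real.sin (β - θ) * u α + Real.sin (θ - α) * u β := by
  have key : ∀ x, α ≤ x → x ≤ β →
      u x = u α * Real.cos (x - α) + (H α - U α) * Real.sin (x - α) := fun x hx1 hx2 => by
    rw [h.representation α x, intervalIntegral.integral_congr_Ioo_of_le (g := fun _ => (0 : ℝ)) hx1]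
    · simp
    · intro s hs
      simp only
      rw [stieltjes_eq_of_inter_support_eq_empty hS hs.1.le (hs.2.trans_le hx2), sub_self, zero_mul]
  rw [key θ h1 h2, key β (h1.trans h2) le_rfl, show β - θ = (β - α) - (θ - α) by ring,
    Real.sin_sub (β - α) (θ - α)]
  ring

/-! ### The shape as an intersection of half-planes -/

/-- The point with polar coordinates `(r, θ)`. -/
noncomputable def polar (r θ : ℝ) : Plane := !₂[r * Real.cos θ, r * Real.sin θ]

theorem exists_polar (x : Plane) : ∃ θ, x = polar ‖x‖ θ := by
  have hn : ‖x‖ = ‖(⟨x 0, x 1⟩ : ℂ)‖ := by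
    rw [EuclideanSpace.norm_eq, Complex.norm_eq_sqrt_sq_add_sq]
    simp [Fin.sum_univ_two]
  refine ⟨Complex.arg ⟨x 0, x 1⟩, ?_⟩
  rw [hn]
  ext i
  fin_cases i
  · simp [polar, Complex.norm_mul_cos_arg]
  · simp [polar, Complex.norm_mul_sin_arg]

/-- The linear form `x ↦ r (u φ cos (θ - φ) + k φ sin (θ - φ))` for `x = (r cos θ, r sin θ)`: if `k`
is a derivative of `u`, the line where it equals `1` supports the shape at the angle `φ`. -/
noncomputable def supportForm (u k : ℝ → ℝ) (φ : ℝ) (x : Plane) : ℝ :=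
  (u φ * Real.cos φ - k φ * Real.sin φ) * x 0 + (u φ * Real.sin φ + k φ * Real.cos φ) * x 1

theorem supportForm_polar (u k : ℝ → ℝ) (φ r θ : ℝ) :
    supportForm u k φ (polar r θ) =
      r * (u φ * Real.cos (θ - φ) + k φ * Real.sin (θ - φ)) := by
  simp only [supportForm, polar, Real.cos_sub, Real.sin_sub, PiLp.toLp_apply, Matrix.cons_val_zero,
    Matrix.cons_val_one]
  ring

theorem supportForm_polar_self (u k : ℝ → ℝ) (r θ : ℝ) :
    supportForm u k θ (polar r θ) = r * u θ := by
  simp [supportForm_polar]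

theorem supportForm_add (u k : ℝ → ℝ) (φ : ℝ) (x y : Plane) :
    supportForm u k φ (x + y) = supportForm u k φ x + supportForm u k φ y := by
  simp only [supportForm, PiLp.add_apply]
  ring

theorem supportForm_smul (u k : ℝ → ℝ) (φ c : ℝ) (x : Plane) :
    supportForm u k φ (c • x) = c * supportForm u k φ x := by
  simp only [supportForm, PiLp.smul_apply, smul_eq_mul]
  ring

theorem continuous_supportForm (u k : ℝ → ℝ) (φ : ℝ) : Continuous (supportForm u k φ) := by
  unfold supportForm
  fun_prop

/-- The closed convex set cut out by the supporting lines. -/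
def supportBody (u k : ℝ → ℝ) : Set Plane := {x | ∀ φ, supportForm u k φ x ≤ 1}

theorem convex_supportBody (u k : ℝ → ℝ) : Convex ℝ (supportBody u k) := by
  intro x hx y hy a b ha hb hab φ
  rw [supportForm_add, supportForm_smul, supportForm_smul]
  have h1 := mul_le_mul_of_nonneg_left (hx φ) ha
  have h2 := mul_le_mul_of_nonneg_left (hy φ) hb
  linarith

theorem isClosed_supportBody (u k : ℝ → ℝ) : IsClosed (supportBody u k) := by
  simp only [supportBody, ofPred_forall]
  exact isClosed_iInter fun φ => isClosed_le (continuous_supportForm u k φ) continuous_const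

section Shape

variable {u k : ℝ → ℝ}

theorem supportForm_polar_le
    (hsup : ∀ φ θ, u φ * Real.cos (θ - φ) + k φ * Real.sin (θ - φ) ≤ u θ)
    {r : ℝ} (hr : 0 ≤ r) (φ θ : ℝ) :
    supportForm u k φ (polar r θ) ≤ r * u θ := by
  rw [supportForm_polar]
  exact mul_le_mul_of_nonneg_left (hsup φ θ) hr

theorem polar_mem_shape_iff
    (hsup : ∀ φ θ, u φ * Real.cos (θ - φ) + k φ * Real.sin (θ - φ) ≤ u θ)
    (hpos : ∀ θ, 0 < u θ) {r : ℝ} (hr : 0 ≤ r) (θ : ℝ) :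
    polar r θ ∈ shape u ↔ r * u θ < 1 := by
  constructor
  · rintro ⟨r', θ', hr', hlt, heq⟩
    change polar r θ = polar r' θ' at heq
    rw [← supportForm_polar_self u k r θ, heq]
    refine (supportForm_polar_le hsup hr' θ θ').trans_lt ?_
    rwa [lt_div_iff₀ (hpos θ')] at hlt
  · intro h
    exact ⟨r, θ, hr, by rwa [lt_div_iff₀ (hpos θ)], rfl⟩

theorem polar_mem_supportBody_iff
    (hsup : ∀ φ θ, u φ * Real.cos (θ - φ) + k φ * Real.sin (θ - φ) ≤ u θ)
    {r : ℝ} (hr : 0 ≤ r) (θ : ℝ) :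
    polar r θ ∈ supportBody u k ↔ r * u θ ≤ 1 :=
  ⟨fun h => by rw [← supportForm_polar_self u k r θ]; exact h θ,
    fun h φ => (supportForm_polar_le hsup hr φ θ).trans h⟩

theorem shape_subset_supportBody
    (hsup : ∀ φ θ, u φ * Real.cos (θ - φ) + k φ * Real.sin (θ - φ) ≤ u θ)
    (hpos : ∀ θ, 0 < u θ) : shape u ⊆ supportBody u k := by
  intro x hx
  obtain ⟨θ, hθ⟩ := exists_polar x
  rw [hθ] at hx ⊢
  exact (polar_mem_supportBody_iff hsup (norm_nonneg x) θ).2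
    ((polar_mem_shape_iff hsup hpos (norm_nonneg x) θ).1 hx).le

theorem isOpen_shape
    (hsup : ∀ φ θ, u φ * Real.cos (θ - φ) + k φ * Real.sin (θ - φ) ≤ u θ)
    (hpos : ∀ θ, 0 < u θ) {B : ℝ} (hB : ∀ θ, u θ ≤ B) : IsOpen (shape u) := by
  have hB0 : 0 < B := (hpos 0).trans_le (hB 0)
  rw [Metric.isOpen_iff]
  intro x hx
  obtain ⟨θ, hθ⟩ := exists_polar x
  have hlt : ‖x‖ * u θ < 1 := by
    rw [hθ] at hx
    exact (polar_mem_shape_iff hsup hpos (norm_nonneg x) θ).1 hx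
  refine ⟨(1 - ‖x‖ * u θ) / B, div_pos (by linarith) hB0, fun y hy => ?_⟩
  obtain ⟨τ, hτ⟩ := exists_polar y
  obtain ⟨σ, hσ⟩ := exists_polar (y - x)
  rw [hτ, polar_mem_shape_iff hsup hpos (norm_nonneg y), ← supportForm_polar_self u k, ← hτ]
  rw [Metric.mem_ball, dist_eq_norm, lt_div_iff₀ hB0] at hy
  have h1 : supportForm u k τ (y - x) ≤ ‖y - x‖ * B := by
    rw [hσ]
    refine (supportForm_polar_le hsup (norm_nonneg _) τ σ).trans ?_
    rw [← hσ]
    exact mul_le_mul_of_nonneg_left (hB σ) (norm_nonneg _)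
  have h2 : supportForm u k τ x ≤ ‖x‖ * u θ := by
    conv_lhs => rw [hθ]
    exact supportForm_polar_le hsup (norm_nonneg _) τ θ
  have h3 : supportForm u k τ y = supportForm u k τ x + supportForm u k τ (y - x) := by
    rw [← supportForm_add, add_sub_cancel]
  linarith

theorem interior_supportBody_subset
    (hsup : ∀ φ θ, u φ * Real.cos (θ - φ) + k φ * Real.sin (θ - φ) ≤ u θ)
    (hpos : ∀ θ, 0 < u θ) :
    interior (supportBody u k) ⊆ shape u := by
  intro x hx
  obtain ⟨θ, hθ⟩ := exists_polar x
  have hle : ‖x‖ * u θ ≤ 1 := by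
    rw [← polar_mem_supportBody_iff hsup (norm_nonneg x) θ, ← hθ]
    exact interior_subset hx
  rw [hθ, polar_mem_shape_iff hsup hpos (norm_nonneg x)]
  refine lt_of_le_of_ne hle fun heq => ?_
  have hev : ∀ᶠ c : ℝ in 𝓝[>] 1, c • x ∈ supportBody u k := by
    have hc : Continuous fun c : ℝ => c • x := by fun_prop
    have : Tendsto (fun c : ℝ => c • x) (𝓝 1) (𝓝 x) := by simpa using hc.tendsto 1
    exact nhdsWithin_le_nhds (this (mem_interior_iff_mem_nhds.1 hx))
  obtain ⟨c, hc1, hc2⟩ := (hev.and self_mem_nhdsWithin).exists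
  have := hc1 θ
  rw [supportForm_smul, hθ, supportForm_polar_self, heq, mul_one] at this
  exact absurd this (not_le.2 hc2)

theorem interior_convexHull_subset_shape
    (hsup : ∀ φ θ, u φ * Real.cos (θ - φ) + k φ * Real.sin (θ - φ) ≤ u θ)
    (hpos : ∀ θ, 0 < u θ) {V : Set Plane}
    (hV : V ⊆ supportBody u k) : interior (convexHull ℝ V) ⊆ shape u :=
  (interior_mono (convexHull_min hV (convex_supportBody u k))).trans
    (interior_supportBody_subset hsup hpos)

/-- On a sector without curvature the shape is a triangle with one vertex at the origin. -/
theorem polar_mem_convexHull (hpos : ∀ θ, 0 < u θ) {α β θ r : ℝ} (hαβ : α < β)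
    (hβ : β < α + Real.pi) (h1 : α ≤ θ) (h2 : θ ≤ β)
    (hu : Real.sin (β - α) * u θ = Real.sin (β - θ) * u α + Real.sin (θ - α) * u β)
    (hr : 0 ≤ r) (hru : r * u θ ≤ 1) {V : Set Plane} (h0 : (0 : Plane) ∈ V)
    (hα : polar (1 / u α) α ∈ V) (hβV : polar (1 / u β) β ∈ V) :
    polar r θ ∈ convexHull ℝ V := by
  have hs : 0 < Real.sin (β - α) := Real.sin_pos_of_pos_of_lt_pi (by linarith) (by linarith)
  have hs1 : 0 ≤ Real.sin (β - θ) := Real.sin_nonneg_of_nonneg_of_le_pi (by linarith) (by linarith)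
  have hs2 : 0 ≤ Real.sin (θ - α) := Real.sin_nonneg_of_nonneg_of_le_pi (by linarith) (by linarith)
  have huα := hpos α
  have huβ := hpos β
  set p := r * Real.sin (β - θ) * u α / Real.sin (β - α) with hp
  set q := r * Real.sin (θ - α) * u β / Real.sin (β - α) with hq
  have hp0 : 0 ≤ p := by positivity
  have hq0 : 0 ≤ q := by positivity
  have hpq : p + q = r * u θ := by
    rw [hp, hq, ← add_div, div_eq_iff hs.ne']
    linear_combination -r * hu
  have hcomb : polar r θ = p • polar (1 / u α) α + q • polar (1 / u β) β +
      (1 - (p + q)) • (0 : Plane) := by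
    have ec : Real.sin (β - α) * Real.cos θ =
        Real.sin (β - θ) * Real.cos α + Real.sin (θ - α) * Real.cos β := by
      simp only [Real.sin_sub]; ring
    have es : Real.sin (β - α) * Real.sin θ =
        Real.sin (β - θ) * Real.sin α + Real.sin (θ - α) * Real.sin β := by
      simp only [Real.sin_sub]; ring
    have e1 : p * (1 / u α) = r * Real.sin (β - θ) / Real.sin (β - α) := by
      rw [hp]; field_simp
    have e2 : q * (1 / u β) = r * Real.sin (θ - α) / Real.sin (β - α) := by
      rw [hq]; field_simp
    rw [smul_zero, add_zero]
    ext i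
    fin_cases i
    · change r * Real.cos θ = p * (1 / u α * Real.cos α) + q * (1 / u β * Real.cos β)
      rw [← mul_assoc, ← mul_assoc, e1, e2]
      field_simp
      linear_combination r * ec
    · change r * Real.sin θ = p * (1 / u α * Real.sin α) + q * (1 / u β * Real.sin β)
      rw [← mul_assoc, ← mul_assoc, e1, e2]
      field_simp
      linear_combination r * es
  have hconv := convex_convexHull ℝ V
  rw [hcomb]
  have hsum := hconv.sum_mem (t := Finset.univ) (w := ![p, q, 1 - (p + q)])
    (z := ![polar (1 / u α) α, polar (1 / u β) β, 0]) ?_ ?_ ?_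
  · simpa [Fin.sum_univ_three] using hsum
  · intro i _
    fin_cases i
    · exact hp0
    · exact hq0
    · change 0 ≤ 1 - (p + q)
      linarith
  · simp [Fin.sum_univ_three]
  · intro i _
    fin_cases i
    · exact subset_convexHull ℝ V hα
    · exact subset_convexHull ℝ V hβV
    · exact subset_convexHull ℝ V h0

end Shape

/-! ### Polygons from finite curvature support -/

theorem exists_polar_mem_Ico (c : ℝ) (x : Plane) :
    ∃ θ ∈ Ico c (c + 2 * Real.pi), x = polar ‖x‖ θ := by
  obtain ⟨θ, hθ⟩ := exists_polar x
  refine ⟨toIcoMod Real.two_pi_pos c θ, toIcoMod_mem_Ico _ _ _, ?_⟩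
  conv_lhs => rw [hθ, ← toIcoMod_add_toIcoDiv_zsmul Real.two_pi_pos c θ]
  simp only [polar, zsmul_eq_mul, Real.cos_add_int_mul_two_pi, Real.sin_add_int_mul_two_pi]

theorem W1inf.exists_le {u : ℝ → ℝ} (hu : W1inf u) : ∃ B, ∀ θ, u θ ≤ B := by
  obtain ⟨B, hB⟩ :=
    (isCompact_Icc (a := (0 : ℝ)) (b := 2 * Real.pi)).bddAbove_image hu.continuous.continuousOn
  refine ⟨B, fun θ => ?_⟩
  have hmem := toIcoMod_mem_Ico Real.two_pi_pos 0 θ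
  rw [zero_add] at hmem
  rw [← toIcoMod_add_toIcoDiv_zsmul Real.two_pi_pos 0 θ, hu.periodic.zsmul]
  exact hB (mem_image_of_mem u (Ico_subset_Icc_self hmem))

/-- The origin and the points of the curve `r = 1 / u` at the angles in `F`. -/
noncomputable def vertexSet (u : ℝ → ℝ) (F : Set ℝ) : Set Plane :=
  insert 0 ((fun s => polar (1 / u s) s) '' F)

theorem finite_vertexSet (u : ℝ → ℝ) {F : Set ℝ} (hF : F.Finite) : (vertexSet u F).Finite :=
  (hF.image _).insert 0

theorem polar_mem_vertexSet (u : ℝ → ℝ) {F : Set ℝ} {s : ℝ} (hs : s ∈ F) :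
    polar (1 / u s) s ∈ vertexSet u F :=
  Or.inr ⟨s, hs, rfl⟩

theorem vertexSet_subset_supportBody {u k : ℝ → ℝ}
    (hsup : ∀ φ θ, u φ * Real.cos (θ - φ) + k φ * Real.sin (θ - φ) ≤ u θ)
    (hpos : ∀ θ, 0 < u θ) (F : Set ℝ) : vertexSet u F ⊆ supportBody u k := by
  rintro _ (rfl | ⟨s, -, rfl⟩)
  · intro φ
    simp [supportForm]
  · rw [polar_mem_supportBody_iff hsup (one_div_nonneg.2 (hpos s).le),
      one_div_mul_cancel (hpos s).ne']

/-- If the curvature of `u` is carried by finitely many angles of a period, then the shape is a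
polygon. -/
theorem isConvexPolygon_shape {u U : ℝ → ℝ} {H : StieltjesFunction ℝ} (hu : W1inf u)
    (hpos : ∀ θ, 0 < u θ) (h : CurvaturePrimitive u U H)
    (hfin : (H.measure.support ∩ Ico 0 (2 * Real.pi)).Finite) : IsConvexPolygon (shape u) := by
  have hpi := Real.pi_pos
  have hsup := h.sinusoid_le hu
  obtain ⟨B, hB⟩ := hu.exists_le
  have hopen := isOpen_shape (k := fun φ => H φ - U φ) hsup hpos hB
  -- the multiples of `π / 2` keep the sectors between consecutive vertices narrower than `π`
  set F : Set ℝ := (H.measure.support ∩ Ico 0 (2 * Real.pi)) ∪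
    {0, Real.pi / 2, Real.pi, 3 * Real.pi / 2, 2 * Real.pi} with hFdef
  have hF : F.Finite := hfin.union (by simp)
  have f0 : (0 : ℝ) ∈ F := by simp [F]
  have f1 : Real.pi / 2 ∈ F := by simp [F]
  have f2 : Real.pi ∈ F := by simp [F]
  have f3 : 3 * Real.pi / 2 ∈ F := by simp [F]
  have f4 : 2 * Real.pi ∈ F := by simp [F]
  refine ⟨⟨polar 0 0, (polar_mem_shape_iff hsup hpos le_rfl 0).2 (by simp)⟩,
    (finite_vertexSet u hF).toFinset, ?_⟩
  rw [Finite.coe_toFinset]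
  refine Subset.antisymm (interior_maximal ?_ hopen)
    (interior_convexHull_subset_shape hsup hpos (vertexSet_subset_supportBody hsup hpos F))
  intro x hx
  obtain ⟨θ, ⟨hθ0, hθ1⟩, hθ⟩ := exists_polar_mem_Ico 0 x
  rw [zero_add] at hθ1
  rw [hθ, polar_mem_shape_iff hsup hpos (norm_nonneg x)] at hx
  obtain ⟨α, ⟨hαF, hαθ⟩, hα⟩ := exists_max_image (F ∩ Iic θ) id (hF.inter_of_left _) ⟨0, f0, hθ0⟩
  obtain ⟨β, ⟨hβF, hθβ⟩, hβ⟩ := exists_min_image (F ∩ Ioi θ) id (hF.inter_of_left _)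
    ⟨2 * Real.pi, f4, hθ1⟩
  simp only [mem_Iic, mem_Ioi, id] at hαθ hθβ hα hβ
  have hα0 : 0 ≤ α := hα 0 ⟨f0, hθ0⟩
  have hβ1 : β ≤ 2 * Real.pi := hβ _ ⟨f4, hθ1⟩
  have hempty : H.measure.support ∩ Ioo α β = ∅ := by
    refine eq_empty_of_forall_notMem ?_
    rintro s ⟨hs, hs1, hs2⟩
    have hsF : s ∈ F := Or.inl ⟨hs, by linarith, by linarith⟩
    rcases le_or_gt s θ with hsθ | hsθ
    · exact absurd (hα s ⟨hsF, hsθ⟩) (not_le.2 hs1)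
    · exact absurd (hβ s ⟨hsF, hsθ⟩) (not_le.2 hs2)
  have hnarrow : β < α + Real.pi := by
    have step : ∀ c d, c ∈ F → d ∈ F → d - c < Real.pi → c ≤ θ → θ < d → β < α + Real.pi :=
      fun c d hc hd hcd h1 h2 => by linarith [hα c ⟨hc, h1⟩, hβ d ⟨hd, h2⟩]
    rcases lt_or_ge θ (Real.pi / 2) with h1 | h1
    · exact step _ _ f0 f1 (by linarith) hθ0 h1
    rcases lt_or_ge θ Real.pi with h2 | h2
    · exact step _ _ f1 f2 (by linarith) h1 h2
    rcases lt_or_ge θ (3 * Real.pi / 2) with h3 | h3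
    · exact step _ _ f2 f3 (by linarith) h2 h3
    · exact step _ _ f3 f4 (by linarith) h3 hθ1
  rw [hθ]
  exact polar_mem_convexHull hpos (hαθ.trans_lt hθβ) hnarrow hαθ hθβ.le
    (h.sin_mul_eq hempty hαθ hθβ.le) (norm_nonneg x) hx.le (mem_insert _ _)
    (polar_mem_vertexSet u hαF) (polar_mem_vertexSet u hβF)

/-- If `φ` is the only angle of `(φ - δ, φ + δ)` that may carry curvature, then in the corresponding
sector the shape coincides with a polygon. -/
theorem exists_polygon_of_isolated {u U : ℝ → ℝ} {H : StieltjesFunction ℝ} (hu : W1inf u)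
    (hpos : ∀ θ, 0 < u θ) (h : CurvaturePrimitive u U H) {φ δ : ℝ} (hδ : 0 < δ)
    (hδπ : δ < Real.pi / 2) (hS : H.measure.support ∩ Ioo (φ - δ) (φ + δ) ⊆ {φ})
    {x : Plane} (hx : x ∈ frontier (shape u)) (hxφ : x = polar ‖x‖ φ) (hx0 : 0 < ‖x‖) :
    ∃ P : Set Plane, IsConvexPolygon P ∧ ∃ N ∈ 𝓝 x, shape u ∩ N = P ∩ N := by
  have hpi := Real.pi_pos
  have hsup := h.sinusoid_le hu
  obtain ⟨B, hB⟩ := hu.exists_le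
  have hopen := isOpen_shape (k := fun φ => H φ - U φ) hsup hpos hB
  set F : Set ℝ := {φ - δ, φ, φ + δ} with hFdef
  have hF : F.Finite := by simp [F]
  have f0 : φ - δ ∈ F := by simp [F]
  have f1 : φ ∈ F := by simp [F]
  have f2 : φ + δ ∈ F := by simp [F]
  have hl : H.measure.support ∩ Ioo (φ - δ) φ = ∅ := by
    refine eq_empty_of_forall_notMem ?_
    rintro s ⟨hs, hs1, hs2⟩
    exact hs2.ne (hS ⟨hs, hs1, by linarith⟩)
  have hr : H.measure.support ∩ Ioo φ (φ + δ) = ∅ := by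
    refine eq_empty_of_forall_notMem ?_
    rintro s ⟨hs, hs1, hs2⟩
    exact hs1.ne' (hS ⟨hs, by linarith, hs2⟩)
  set N : Set Plane := {y | Real.cos δ * ‖y‖ < Real.cos φ * y 0 + Real.sin φ * y 1} with hN
  have hNopen : IsOpen N := isOpen_lt (by fun_prop) (by fun_prop)
  have hform : ∀ r θ, Real.cos φ * polar r θ 0 + Real.sin φ * polar r θ 1 =
      r * Real.cos (θ - φ) := fun r θ => by
    simp only [polar, Real.cos_sub, PiLp.toLp_apply, Matrix.cons_val_zero, Matrix.cons_val_one]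
    ring
  have hxN : x ∈ N := by
    have h1 := hform ‖x‖ φ
    rw [← hxφ, sub_self, Real.cos_zero, mul_one] at h1
    change Real.cos δ * ‖x‖ < _
    rw [h1]
    have h2 : Real.cos δ < 1 := by
      rw [← Real.cos_zero]
      exact Real.cos_lt_cos_of_nonneg_of_le_pi_div_two le_rfl hδπ.le hδ
    nlinarith
  have hsub : shape u ∩ N ⊆ interior (convexHull ℝ (vertexSet u F)) := by
    refine interior_maximal ?_ (hopen.inter hNopen)
    rintro y ⟨hy, hyN⟩
    obtain ⟨θ, ⟨hθ0, hθ1⟩, hθ⟩ := exists_polar_mem_Ico (φ - Real.pi) y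
    have hyu : ‖y‖ * u θ < 1 := by
      rw [hθ] at hy
      exact (polar_mem_shape_iff hsup hpos (norm_nonneg y) θ).1 hy
    have hyc : Real.cos δ * ‖y‖ < ‖y‖ * Real.cos (θ - φ) := by
      rw [← hform, ← hθ]
      exact hyN
    have hcos : Real.cos δ < Real.cos (θ - φ) := by
      rw [mul_comm] at hyc
      exact lt_of_mul_lt_mul_left hyc (norm_nonneg y)
    have habs : |θ - φ| < δ := by
      by_contra! hle
      rw [← Real.cos_abs (θ - φ)] at hcos
      refine absurd hcos (not_lt.2 (Real.cos_le_cos_of_nonneg_of_le_pi hδ.le ?_ hle))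
      rw [abs_le]
      constructor <;> linarith
    rw [abs_lt] at habs
    rw [hθ]
    rcases le_total θ φ with hle | hle
    · exact polar_mem_convexHull hpos (α := φ - δ) (β := φ) (by linarith) (by linarith)
        (by linarith) hle (h.sin_mul_eq hl (by linarith) hle) (norm_nonneg y) hyu.le
        (mem_insert _ _) (polar_mem_vertexSet u f0) (polar_mem_vertexSet u f1)
    · exact polar_mem_convexHull hpos (α := φ) (β := φ + δ) (by linarith) (by linarith)
        hle (by linarith) (h.sin_mul_eq hr hle (by linarith)) (norm_nonneg y) hyu.le
        (mem_insert _ _) (polar_mem_vertexSet u f1) (polar_mem_vertexSet u f2)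
  have hNx : N ∈ 𝓝 x := hNopen.mem_nhds hxN
  obtain ⟨y, hyN, hyu⟩ := mem_closure_iff_nhds.1 (frontier_subset_closure hx) N hNx
  refine ⟨interior (convexHull ℝ (vertexSet u F)), ⟨⟨y, hsub ⟨hyu, hyN⟩⟩,
    (finite_vertexSet u hF).toFinset, by rw [Finite.coe_toFinset]⟩, N, hNx, ?_⟩
  exact Subset.antisymm (fun y hy => ⟨hsub hy, hy.2⟩) (inter_subset_inter_left N
    (interior_convexHull_subset_shape hsup hpos (vertexSet_subset_supportBody hsup hpos F)))

theorem locallyPolygonalIn_openAnnulus {u U : ℝ → ℝ} {H : StieltjesFunction ℝ} (hu : W1inf u)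
    (hpos : ∀ θ, 0 < u θ) (h : CurvaturePrimitive u U H) {a b : ℝ} (ha : 0 < a) (hb : 0 < b)
    (hfin : ∀ γ₁ γ₂ : ℝ, Ioo γ₁ γ₂ ⊆ {θ | a < u θ ∧ u θ < b} →
      (H.measure.support ∩ Ioo γ₁ γ₂).Finite) :
    LocallyPolygonalIn (shape u) (openAnnulus a b) := by
  rintro x ⟨hx, hx1, hx2⟩
  have hpi := Real.pi_pos
  have hsup := h.sinusoid_le hu
  obtain ⟨B, hB⟩ := hu.exists_le
  have hopen := isOpen_shape (k := fun φ => H φ - U φ) hsup hpos hB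
  obtain ⟨φ, hφ⟩ := exists_polar x
  have hx0 : 0 < ‖x‖ := (one_div_pos.2 hb).trans hx1
  have hru : ‖x‖ * u φ = 1 := by
    refine le_antisymm ?_ (not_lt.1 fun hlt => ?_)
    · rw [← polar_mem_supportBody_iff (k := fun φ => H φ - U φ) hsup (norm_nonneg x), ← hφ]
      exact closure_minimal (shape_subset_supportBody hsup hpos) (isClosed_supportBody _ _)
        (frontier_subset_closure hx)
    · rw [← polar_mem_shape_iff hsup hpos (norm_nonneg x), ← hφ] at hlt
      rw [hopen.frontier_eq] at hx
      exact hx.2 hlt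
  have hφmem : φ ∈ {θ | a < u θ ∧ u θ < b} := by
    rw [div_lt_iff₀ hb] at hx1
    rw [lt_div_iff₀ ha] at hx2
    exact ⟨lt_of_mul_lt_mul_left (hx2.trans_eq hru.symm) hx0.le,
      lt_of_mul_lt_mul_left (hru.trans_lt hx1) hx0.le⟩
  have hnhds : {θ | a < u θ ∧ u θ < b} ∈ 𝓝 φ :=
    ((isOpen_lt continuous_const hu.continuous).inter
      (isOpen_lt hu.continuous continuous_const)).mem_nhds hφmem
  obtain ⟨ε, hε, hball⟩ := Metric.mem_nhds_iff.1 hnhds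
  rw [Real.ball_eq_Ioo] at hball
  have hF := (hfin _ _ hball).sdiff (t := {φ})
  obtain ⟨η, hη, hball'⟩ := Metric.mem_nhds_iff.1
    (hF.isClosed.isOpen_compl.mem_nhds (x := φ) (by simp))
  rw [Real.ball_eq_Ioo] at hball'
  refine exists_polygon_of_isolated hu hpos h (φ := φ) (δ := min (min ε η) (Real.pi / 3))
    (lt_min (lt_min hε hη) (by linarith)) ((min_le_right _ _).trans_lt (by linarith)) ?_ hx hφ hx0
  have h1 : min (min ε η) (Real.pi / 3) ≤ ε := (min_le_left _ _).trans (min_le_left _ _)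
  have h2 : min (min ε η) (Real.pi / 3) ≤ η := (min_le_left _ _).trans (min_le_right _ _)
  rintro s ⟨hs, hs1, hs2⟩
  by_contra hne
  exact hball' ⟨by linarith, by linarith⟩ ⟨⟨hs, by linarith, by linarith⟩, hne⟩

end ConvexShape

theorem theorem2p1 (G : ℝ → ℝ → ℝ → ℝ)
    (hG : ContDiff ℝ 2 (fun x : ℝ × ℝ × ℝ => G x.1 x.2.1 x.2.2))
    (hper : ∀ θ u p : ℝ, G (θ + 2 * Real.pi) u p = G θ u p)
    (u₀ : ℝ → ℝ) (hconc : ConvexShape.StronglyConcaveAlong G u₀) :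
    (∀ a b : ℝ, 0 < a → a < b →
      ConvexShape.IsSolution G (ConvexShape.annulusClass a b) u₀ →
        ∃ ν : Measure ℝ, ConvexShape.IsCurvatureMeasure u₀ ν ∧
          (∀ γ₁ γ₂ : ℝ, Ioo γ₁ γ₂ ⊆ {θ | a < u₀ θ ∧ u₀ θ < b} →
            (ν.support ∩ Ioo γ₁ γ₂).Finite) ∧
          ConvexShape.LocallyPolygonalIn (ConvexShape.shape u₀)
            (ConvexShape.openAnnulus a b)) ∧
    (∀ m₀ : ℝ, 0 < m₀ → (∀ θ, 0 < u₀ θ) →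
      ConvexShape.IsSolution G (ConvexShape.areaClass m₀) u₀ →
        ∃ ν : Measure ℝ, ConvexShape.IsCurvatureMeasure u₀ ν ∧
          (ν.support ∩ Ico 0 (2 * Real.pi)).Finite ∧
          ConvexShape.IsConvexPolygon (ConvexShape.shape u₀)) := by
  refine ⟨fun a b ha hab hsol => ?_, fun m₀ hm₀ hpos hsol => ?_⟩
  · obtain ⟨U, H, h⟩ := hsol.1.2.1.exists_stieltjes hsol.1.1
    have hfin := fun γ₁ γ₂ =>
      ConvexShape.finite_support_of_annulus hG hper h hconc hsol (γ₁ := γ₁) (γ₂ := γ₂)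
    exact ⟨H.measure, h.isCurvatureMeasure, hfin,
      ConvexShape.locallyPolygonalIn_openAnnulus hsol.1.1
        (fun θ => ha.trans_le (hsol.1.2.2 θ).1) h ha (ha.trans hab) hfin⟩
  · obtain ⟨U, H, h⟩ := hsol.1.2.1.exists_stieltjes hsol.1.1
    have hfin : (H.measure.support ∩ Ico 0 (2 * Real.pi)).Finite :=
      (ConvexShape.finite_support_of_area hG hper h hconc hm₀ hpos hsol (-1)
        (2 * Real.pi)).subset
        (inter_subset_inter_right _ fun θ hθ => ⟨by linarith [hθ.1], hθ.2⟩)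
    exact ⟨H.measure, h.isCurvatureMeasure, hfin,
      ConvexShape.isConvexPolygon_shape hsol.1.1 hpos h hfin⟩
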